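/- **Setting.** Let $d\ge 1$. Let $0<\mu_1\le\mu_2\le\cdots$ be real numbers, let $M_0>0$, and put $M_j:=M_0\mu_1\cdots\mu_j$ for $j\ge 1$. Let $K\subseteq\mathbb{R}^d$ be a convex body (convex, compact, with non-empty interior) of diameter $\delta_K$, and let $b>0$. Put $j_0:=\min\{j\in\mathbb{Z}_{\ge 0}: j\ge \log (M_0/b)\}$ and assume $$\sum_{j=j_0+1}^{\infty}\frac1{\mu_j}>\delta_K\, e$$ (the sum may be $\infty$); that is, $(M,K,2b)$ is *admissible data*. The *associated integer* is $$N:=1+\sup\Big\{n\in\mathbb{Z}_{\ge 0}:\ \sum_{j=j_0+1}^{n}\frac{1}{\delta_K\mu_j}<e\Big\},$$ which is finite. Let $\tilde\mu:[1,\infty)\to(0,\infty)$ be any increasing (i.e. non-decreasing), continuous, piecewise $\mathcal{C}^1$ function with $\tilde\mu(k)=\mu_k$ for all integers $k\ge 1$, and for $n\ge 1$ set $$\gamma_{\tilde\mu}(n):=\sup_{1\le s\le n}\frac{s\,\tilde\mu'(s)}{\tilde\mu(s)},\qquad \Gamma_{\tilde\mu}(n):=4e^{4+\gamma_{\tilde\mu}(n)},$$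 where $\tilde\mu'(s)$ is the left derivative at points $s>1$ at which $\tilde\mu$ is not differentiable, and the right derivative at $s=1$. For $N\ge 2$ put $C_N:=\Gamma_{\tilde\mu}(2(N-1))$. For a set $S$ write $\|f\|_S:=\sup_{x\in S}|f(x)|$. For an integer $n\ge 0$, a function $f:K\to\mathbb{R}$ is called *$M^{|n}$-smooth* on $K$ if it is of class $\mathcal{C}^n$ in an open neighbourhood of $K$ and $$\sum_{|\alpha|=j}\frac{j!}{\alpha!}\,\|f^{(\alpha)}\|_K\le M_j\qquad\text{for all } 0\le j\le n .$$ **Theorem.** Assume $N\ge 2$. Let $f:K\to\mathbb{R}$ be $M^{|2(N-1)}$-smooth on $K$, let $L\subseteq K$ be a convex body with $\|f\|_L\ge b$, and let $E\subseteq L$ be a Lebesgue measurable set with Lebesgue measure $|E|>0$. Then $$\|f\|_L\le\left(\frac{C_N\,|L|^{1/d}}{|L|^{1/d}-(|L|-|E|)^{1/d}}\right)^{2(N-1)}\|f\|_E .$$ (If $N=1$, the right-hand side is interpreted as $+\infty$ and nothing is claimed.) -/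

import Mathlib

open MeasureTheory

noncomputable section

namespace Remez

/-- A full admissible weight `M^{|∞}` all of whose members are finite: a positive increasing
sequence `μ_1 ≤ μ_2 ≤ ⋯` (the value `μ 0` is not used) together with a number `M_0 > 0`. -/
structure FullWeight where
  μ : ℕ → ℝ
  M0 : ℝ
  μ_pos : ∀ j, 1 ≤ j → 0 < μ j
  μ_mono : ∀ i j, 1 ≤ i → i ≤ j → μ i ≤ μ j
  M0_pos : 0 < M0

/-- `M_j = M_0 μ_1 ⋯ μ_j`. -/
def FullWeight.M (W : FullWeight) (j : ℕ) : ℝ := W.M0 * ∏ i ∈ Finset.Icc 1 j, W.μ i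

/-- A convex body in `ℝ^d`: convex, compact, with non-empty interior. -/
def IsConvexBody {d : ℕ} (K : Set (EuclideanSpace ℝ (Fin d))) : Prop :=
  Convex ℝ K ∧ IsCompact K ∧ (interior K).Nonempty

/-- The sup-norm `‖f‖_S = sup_{x ∈ S} |f x|`. -/
def supNorm {d : ℕ} (f : EuclideanSpace ℝ (Fin d) → ℝ) (S : Set (EuclideanSpace ℝ (Fin d))) : ℝ :=
  sSup ((fun x => |f x|) '' S)

/-- The partial derivative `f^{(α)}` of multi-index `α`: the derivative of order
`|α| = α_1 + ⋯ + α_d`, evaluated on the tuple that contains the basis vector `e_i`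
exactly `α_i` times. -/
def partialDeriv {d : ℕ} (α : Fin d → ℕ) (f : EuclideanSpace ℝ (Fin d) → ℝ)
    (x : EuclideanSpace ℝ (Fin d)) : ℝ :=
  iteratedFDeriv ℝ (∑ i, α i) f x
    (fun k => EuclideanSpace.single (finSigmaFinEquiv.symm k).1 (1 : ℝ))

/-- `‖f‖_{j,K} = ∑_{|α| = j} (j! / α!) ‖f^{(α)}‖_K`. -/
def derivNorm {d : ℕ} (j : ℕ) (f : EuclideanSpace ℝ (Fin d) → ℝ)
    (K : Set (EuclideanSpace ℝ (Fin d))) : ℝ :=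
  ∑ α ∈ Finset.piAntidiag (Finset.univ : Finset (Fin d)) j,
    ((j.factorial : ℝ) / ∏ i, ((α i).factorial : ℝ)) * supNorm (partialDeriv α f) K

/-- `f` is `M^{|n}`-smooth on `K`, where `M^{|n}` is the weight obtained from `M^{|∞}` by setting
all members of index greater than `n` equal to `∞` (for these the bound is void):
`f` is of class `C^n` in an open neighbourhood of `K` and `‖f‖_{j,K} ≤ M_j` for `0 ≤ j < n + 1`. -/
def FullWeight.IsSmooth (W : FullWeight) (n : ℕ∞) {d : ℕ}
    (K : Set (EuclideanSpace ℝ (Fin d))) (f : EuclideanSpace ℝ (Fin d) → ℝ) : Prop :=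
  (∃ U : Set (EuclideanSpace ℝ (Fin d)), IsOpen U ∧ K ⊆ U ∧ ContDiffOn ℝ n f U) ∧
    ∀ j : ℕ, (j : ℕ∞) ≤ n → derivNorm j f K ≤ W.M j

/-- `j_0(b)`, the smallest natural number `j ≥ log (b⁻¹)`. -/
def jZero (b : ℝ) : ℕ := ⌈Real.log b⁻¹⌉₊

/-- The `μ`-degree `sup {n ∈ ℕ : ∑_{j = j_0(b)+1}^n 1/μ_j < e}`, an element of `ℕ ∪ {∞}`. -/
def degree (μ : ℕ → ℝ) (b : ℝ) : ℕ∞ :=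
  sSup ((fun n : ℕ => (n : ℕ∞)) ''
    {n : ℕ | ∑ j ∈ Finset.Icc (jZero b + 1) n, 1 / μ j < Real.exp 1})

/-- `(M^{|∞}, K, b)` is admissible data: `K` is a convex body, `b > 0`, and
`∑_{j > j_0} 1/μ_j > δ_K e`, where `j_0 = j_0(b / (2 M_0))` and `δ_K` is the diameter of `K`.
The series may diverge, and is therefore summed in `[0, ∞]`. -/
def AdmissibleData (W : FullWeight) {d : ℕ} (K : Set (EuclideanSpace ℝ (Fin d))) (b : ℝ) : Prop :=
  IsConvexBody K ∧ 0 < b ∧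
    ENNReal.ofReal (Metric.diam K * Real.exp 1) <
      ∑' i : ℕ, ENNReal.ofReal (1 / W.μ (jZero (b / (2 * W.M0)) + 1 + i))

/-- `N` is the integer associated with the data `(M^{|∞}, K, b)`: it equals one plus the
`(δ_K μ)`-degree at `b / (2 M_0)`. For admissible data this degree is finite. -/
def IsAssociatedInteger (W : FullWeight) {d : ℕ} (K : Set (EuclideanSpace ℝ (Fin d))) (b : ℝ)
    (N : ℕ) : Prop :=
  (N : ℕ∞) = degree (fun j => Metric.diam K * W.μ j) (b / (2 * W.M0)) + 1

/-- `g` is piecewise `C^1` on `[1, ∞)`: there are `1 = a_0 < a_1 < ⋯ → ∞` such that `g` is `C^1`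
on every closed interval `[a_k, a_{k+1}]` (one-sided derivatives at its end points). -/
def PiecewiseC1 (g : ℝ → ℝ) : Prop :=
  ∃ a : ℕ → ℝ, a 0 = 1 ∧ StrictMono a ∧ Filter.Tendsto a Filter.atTop Filter.atTop ∧
    ∀ k, ContDiffOn ℝ 1 g (Set.Icc (a k) (a (k + 1)))

/-- `g` is an increasing, continuous, piecewise `C^1` function `[1, ∞) → (0, ∞)` with
`g k = μ_k` for all `k ≥ 1`. (Values of `g` outside `[1, ∞)` play no role.) -/
def FullWeight.IsInterpolation (W : FullWeight) (g : ℝ → ℝ) : Prop :=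
  MonotoneOn g (Set.Ici 1) ∧ ContinuousOn g (Set.Ici 1) ∧ (∀ s, 1 ≤ s → 0 < g s) ∧
    PiecewiseC1 g ∧ ∀ k : ℕ, 1 ≤ k → g k = W.μ k

/-- The derivative of a piecewise `C^1` function on `[1, ∞)`, with the convention that it is the
left derivative where the two one-sided derivatives differ; at the end point `1` of the domain it
is the right derivative. -/
def leftDeriv (g : ℝ → ℝ) (s : ℝ) : ℝ :=
  if s = 1 then derivWithin g (Set.Ici 1) 1 else derivWithin g (Set.Iic s) s

/-- `γ_g(n) = sup_{1 ≤ s ≤ n} s g'(s) / g(s)`. -/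
def gammaConst (g : ℝ → ℝ) (n : ℕ) : ℝ :=
  sSup ((fun s : ℝ => s * leftDeriv g s / g s) '' Set.Icc 1 (n : ℝ))

/-- `Γ_g(n) = 4 e^{4 + γ_g(n)}`. -/
def GammaConst (g : ℝ → ℝ) (n : ℕ) : ℝ := 4 * Real.exp (4 + gammaConst g n)

end Remez

end

/-!
Let `x₀ ∈ L` be a point with `|f x₀| = ‖f‖_L`. In polar coordinates around `x₀` there is a ray on
which `E` fills at least the proportion `c = 1 - (1 - |E| / |L|) ^ (1 / d)` of the part of the ray
in `L`, up to an arbitrarily small loss in `c`. This reduces the claim to a function on an interval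
`[0, l]` with bounds `M_j` on its derivatives, the point `x₀` corresponding to the end point `0`.

Put `q = 2 (N - 1)` and suppose that the claim fails on that interval. The small set contains `q`
points with large gaps, and the polynomial that interpolates the function there has very small
derivatives. By Rolle's theorem the `j`-th derivatives of the function and of the polynomial
coincide at some point `x_j`, where `x_0 ≤ x_1 ≤ ⋯`; hence the `j`-th derivative of the function is
at most `e^{j - q} M_j` at `x_j`. Bang's argument propagates this smallness to the left, and
`∑ 1 / μ_j ≥ e l` is what it takes to reach `0` with a value less than `e^{-j₀} M_0 ≤ b`, which
contradicts `‖f‖_L ≥ b`. The constant `γ` enters through the lower bound for `M_j` that the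
smallness of the polynomial is measured against.
-/

namespace Remez

open Real Set Topology

namespace FullWeight

theorem M_zero (W : FullWeight) : W.M 0 = W.M0 := by simp [M]

theorem M_succ (W : FullWeight) (j : ℕ) : W.M (j + 1) = W.M j * W.μ (j + 1) := by
  simp [M, Finset.prod_Icc_succ_top, mul_assoc]

theorem M_pos (W : FullWeight) (j : ℕ) : 0 < W.M j :=
  mul_pos W.M0_pos (Finset.prod_pos fun i hi => W.μ_pos i (Finset.mem_Icc.1 hi).1)

theorem M_le_M {W V : FullWeight} {q : ℕ} (h0 : W.M0 = V.M0)
    (h : ∀ i, 1 ≤ i → i ≤ q → W.μ i ≤ V.μ i) {j : ℕ} (hj : j ≤ q) : W.M j ≤ V.M j := by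
  unfold M
  rw [h0]
  refine mul_le_mul_of_nonneg_left (Finset.prod_le_prod (fun i hi => ?_) fun i hi => ?_)
    V.M0_pos.le
  · exact (W.μ_pos i (Finset.mem_Icc.1 hi).1).le
  · exact h i (Finset.mem_Icc.1 hi).1 ((Finset.mem_Icc.1 hi).2.trans hj)

/-- `D 0, …, D q` are the successive derivatives of a function on `S ⊆ ℝ`, and `|D j| ≤ M_j`
there: the one-dimensional form of `M^{|q}`-smoothness, met along lines in `ℝ^d`. -/
structure IsSmoothChain (W : FullWeight) (q : ℕ) (D : ℕ → ℝ → ℝ) (S : Set ℝ) : Prop where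
  hasDerivAt : ∀ j < q, ∀ t ∈ S, HasDerivAt (D j) (D (j + 1) t) t
  abs_le : ∀ j ≤ q, ∀ t ∈ S, |D j t| ≤ W.M j

theorem IsSmoothChain.mono {W V : FullWeight} {q : ℕ} {D : ℕ → ℝ → ℝ} {S T : Set ℝ}
    (hD : W.IsSmoothChain q D S) (hWV : ∀ j ≤ q, W.M j ≤ V.M j) (hTS : T ⊆ S) :
    V.IsSmoothChain q D T :=
  ⟨fun j hj t ht => hD.hasDerivAt j hj t (hTS ht),
    fun j hj t ht => (hD.abs_le j hj t (hTS ht)).trans (hWV j hj)⟩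

end FullWeight

theorem exists_monotone_zeros_of_hasDerivAt {S : Set ℝ} (hS : S.OrdConnected) (n : ℕ)
    (G : ℕ → ℝ → ℝ) (z : ℕ → ℝ) (hG : ∀ j < n, ∀ t ∈ S, HasDerivAt (G j) (G (j + 1) t) t)
    (hz : ∀ i < n, z i < z (i + 1)) (hzS : ∀ i ≤ n, z i ∈ S) (h0 : ∀ i ≤ n, G 0 (z i) = 0) :
    ∃ x : ℕ → ℝ, x 0 = z 0 ∧ (∀ j < n, x j ≤ x (j + 1)) ∧
      (∀ j ≤ n, x j ∈ Icc (z 0) (z n)) ∧ ∀ j ≤ n, G j (x j) = 0 := by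
  induction n generalizing G z with
  | zero => exact ⟨z, rfl, by simp, by simp, by simpa using h0⟩
  | succ n ih =>
    have rolle : ∀ i, ∃ c, i ≤ n → c ∈ Ioo (z i) (z (i + 1)) ∧ G 1 c = 0 := by
      intro i
      by_cases hi : i ≤ n
      · have hG0 : ∀ t ∈ Icc (z i) (z (i + 1)), HasDerivAt (G 0) (G 1 t) t := fun t ht =>
          hG 0 n.succ_pos t (hS.out (hzS i (by omega)) (hzS (i + 1) (by omega)) ht)
        obtain ⟨c, hc, hc0⟩ := exists_hasDerivAt_eq_zero (hz i (by omega))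
          (fun t ht => (hG0 t ht).continuousAt.continuousWithinAt)
          ((h0 i (by omega)).trans (h0 (i + 1) (by omega)).symm)
          (fun t ht => hG0 t (Ioo_subset_Icc_self ht))
        exact ⟨c, fun _ => ⟨hc, hc0⟩⟩
      · exact ⟨0, fun h => absurd h hi⟩
    choose c hc using rolle
    obtain ⟨x, hx0, hxm, hxI, hxz⟩ := ih (fun j => G (j + 1)) c
      (fun j hj => hG (j + 1) (by omega))
      (fun i hi => (hc i (by omega)).1.2.trans (hc (i + 1) (by omega)).1.1)
      (fun i hi => hS.out (hzS i (by omega)) (hzS (i + 1) (by omega))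
        (Ioo_subset_Icc_self (hc i hi).1))
      (fun i hi => (hc i hi).2)
    have hzc : z 0 < c 0 := (hc 0 (by omega)).1.1
    have hcz : c n < z (n + 1) := (hc n le_rfl).1.2
    have hxI' : ∀ j ≤ n, x j ∈ Icc (z 0) (z (n + 1)) := fun j hj =>
      Icc_subset_Icc hzc.le hcz.le (hxI j hj)
    refine ⟨fun j => Nat.casesOn j (z 0) x, rfl, ?_, ?_, ?_⟩
    · rintro (_ | j) hj
      · exact hzc.le.trans_eq hx0.symm
      · exact hxm j (by omega)
    · rintro (_ | j) hj
      · exact ⟨le_rfl, (hxI' 0 n.zero_le).1.trans (hxI' 0 n.zero_le).2⟩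
      · exact hxI' j (by omega)
    · rintro (_ | j) hj
      · exact h0 0 (by omega)
      · exact hxz j (by omega)

theorem norm_left_le_of_norm_deriv_le {F : Type*} [NormedAddCommGroup F] [NormedSpace ℝ F]
    {f f' : ℝ → F} {B B' : ℝ → ℝ} {a b : ℝ} (hab : a ≤ b)
    (hf : ∀ t ∈ Icc a b, HasDerivAt f (f' t) t) (hb : ‖f b‖ ≤ B b)
    (hB : ∀ t, HasDerivAt B (B' t) t) (bound : ∀ t ∈ Icc a b, ‖f' t‖ ≤ -B' t) :
    ‖f a‖ ≤ B a := by
  have hneg : ∀ s ∈ Icc (-b) (-a), -s ∈ Icc a b := fun s hs =>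
    ⟨le_neg.2 hs.2, neg_le.2 hs.1⟩
  have hfr : ∀ s ∈ Icc (-b) (-a), HasDerivAt (fun s => f (-s)) (-f' (-s)) s := fun s hs => by
    simpa [Function.comp_def] using (hf (-s) (hneg s hs)).scomp s (hasDerivAt_neg s)
  have hBr : ∀ s, HasDerivAt (fun s => B (-s)) (-B' (-s)) s := fun s => by
    simpa [Function.comp_def] using (hB (-s)).scomp s (hasDerivAt_neg s)
  simpa using image_norm_le_of_norm_deriv_right_le_deriv_boundary
    (fun s hs => (hfr s hs).continuousAt.continuousWithinAt)
    (fun s hs => (hfr s (Ico_subset_Icc_self hs)).hasDerivWithinAt)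
    (by simpa using hb) hBr
    (fun s hs => by simpa using bound _ (hneg s (Ico_subset_Icc_self hs)))
    (right_mem_Icc.2 (neg_le_neg hab))

/-- The data of Bang's argument: a smooth chain on `[a, b]` whose `j`-th derivative is exponentially
small at a point `x j`, where the points `x 0 ≤ ⋯ ≤ x (q - 1)` move to the right. -/
structure FullWeight.IsBangChain (W : FullWeight) (q : ℕ) (D : ℕ → ℝ → ℝ) (x : ℕ → ℝ) (a b : ℝ) :
    Prop extends W.IsSmoothChain q D (Icc a b) where
  le_succ : ∀ j, j + 1 < q → x j ≤ x (j + 1)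
  mem_Icc : ∀ j < q, x j ∈ Icc a b
  abs_le_exp : ∀ j < q, |D j (x j)| ≤ exp ((j : ℝ) - q) * W.M j

/-- Smallness of level `m` at `t`: each derivative of order `j < m` that has its small point to the
right of `t` is at most `e^{j - m} M_j` at `t`. -/
def FullWeight.IsBangSmall (W : FullWeight) (D : ℕ → ℝ → ℝ) (x : ℕ → ℝ) (m : ℕ) (t : ℝ) : Prop :=
  ∀ j < m, t ≤ x j → |D j t| ≤ exp ((j : ℝ) - m) * W.M j

/-- The bound for the `j`-th derivative that smallness of level `m` at `c` propagates to the points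
to the left of `c`. -/
noncomputable def FullWeight.bangBound (W : FullWeight) (m : ℕ) (c : ℝ) (j : ℕ) (t : ℝ) : ℝ :=
  exp ((j : ℝ) - m) * W.M j * exp (exp 1 * W.μ m * (c - t))

/-- The threshold to the right of which smallness of level `m` holds. -/
noncomputable def FullWeight.bangLevel (W : FullWeight) (q : ℕ) (b : ℝ) (m : ℕ) : ℝ :=
  b - ∑ i ∈ Finset.Ioc m q, 1 / (exp 1 * W.μ i)

section Bang

variable {W : FullWeight} {q m j : ℕ} {D : ℕ → ℝ → ℝ} {x : ℕ → ℝ} {a b c t : ℝ}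

theorem FullWeight.bangBound_pos : 0 < W.bangBound m c j t :=
  mul_pos (mul_pos (exp_pos _) (W.M_pos j)) (exp_pos _)

theorem FullWeight.le_bangBound (hm : 1 ≤ m) (ht : t ≤ c) :
    exp ((j : ℝ) - m) * W.M j ≤ W.bangBound m c j t :=
  le_mul_of_one_le_right (mul_pos (exp_pos _) (W.M_pos j)).le <| one_le_exp <|
    mul_nonneg (mul_pos (exp_pos 1) (W.μ_pos m hm)).le (sub_nonneg.2 ht)

theorem FullWeight.hasDerivAt_bangBound :
    HasDerivAt (W.bangBound m c j) (-(exp 1 * W.μ m * W.bangBound m c j t)) t := by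
  unfold bangBound
  have h : HasDerivAt (fun s : ℝ => exp 1 * W.μ m * (c - s)) (exp 1 * W.μ m * (-1)) t :=
    ((hasDerivAt_id t).const_sub c).const_mul _
  convert! h.exp.const_mul (exp ((j : ℝ) - m) * W.M j) using 1
  ring

theorem FullWeight.bangBound_succ_le (hj : j < m) :
    W.bangBound m c (j + 1) t ≤ exp 1 * W.μ m * W.bangBound m c j t := by
  have hexp : exp (((j + 1 : ℕ) : ℝ) - m) = exp 1 * exp ((j : ℝ) - m) := by
    rw [← exp_add]; congr 1; push_cast; ring
  calc W.bangBound m c (j + 1) t = exp 1 * W.μ (j + 1) * W.bangBound m c j t := by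
        unfold bangBound
        rw [hexp, W.M_succ]; ring
    _ ≤ exp 1 * W.μ m * W.bangBound m c j t := by
        have := (W.bangBound_pos (m := m) (c := c) (j := j) (t := t)).le
        have := W.μ_mono (j + 1) m (by omega) hj
        gcongr

namespace FullWeight.IsBangChain

/-- Between `t` and the point `min c (x j)`, where the bound is known, the derivative of `D j` is
controlled by that of the bound. -/
theorem abs_le_bangBound_of_succ (hD : W.IsBangChain q D x a b) (hmq : m ≤ q) (hcb : c ≤ b)
    (hc : W.IsBangSmall D x m c) (hj : j < m)
    (hsucc : ∀ t ∈ Icc a c, (j + 1 < m → t ≤ x (j + 1)) → |D (j + 1) t| ≤ W.bangBound m c (j + 1) t)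
    (ht : t ∈ Icc a c) (htx : t ≤ x j) : |D j t| ≤ W.bangBound m c j t := by
  have hcx : min c (x j) ≤ c := min_le_left _ _
  have hend : |D j (min c (x j))| ≤ W.bangBound m c j (min c (x j)) := by
    refine le_trans ?_ (W.le_bangBound (by omega) hcx)
    rcases le_total c (x j) with h | h
    · rw [min_eq_left h]
      exact hc j hj h
    · rw [min_eq_right h]
      refine (hD.abs_le_exp j (by omega)).trans ?_
      have := (W.M_pos j).le
      gcongr
  refine norm_left_le_of_norm_deriv_le (le_min ht.2 htx)
    (fun s hs => hD.hasDerivAt j (by omega) s ⟨ht.1.trans hs.1, hs.2.trans (hcx.trans hcb)⟩) hend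
    (fun s => W.hasDerivAt_bangBound) fun s hs => ?_
  rw [neg_neg]
  exact (hsucc s ⟨ht.1.trans hs.1, hs.2.trans hcx⟩ fun h =>
    (hs.2.trans (min_le_right _ _)).trans (hD.le_succ j (by omega))).trans (W.bangBound_succ_le hj)

theorem abs_le_bangBound (hD : W.IsBangChain q D x a b) (hmq : m ≤ q) (hcb : c ≤ b)
    (hc : W.IsBangSmall D x m c) (hj : j < m) (ht : t ∈ Icc a c) (htx : t ≤ x j) :
    |D j t| ≤ W.bangBound m c j t := by
  induction h : m - j generalizing j t with
  | zero => omega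
  | succ i ih =>
    refine hD.abs_le_bangBound_of_succ hmq hcb hc hj (fun s hs hsx => ?_) ht htx
    rcases hj.nat_succ_le.lt_or_eq with hjm | rfl
    · exact ih hjm hs (hsx hjm) (by omega)
    · refine (hD.abs_le _ hmq s ⟨hs.1, hs.2.trans hcb⟩).trans ?_
      simpa using W.le_bangBound (j := j + 1) (Nat.le_add_left 1 j) hs.2

theorem bangLevel_le : W.bangLevel q b m ≤ b := by
  refine sub_le_self _ (Finset.sum_nonneg fun i hi => ?_)
  have := W.μ_pos i (by have := Finset.mem_Ioc.1 hi; omega)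
  positivity

theorem bangLevel_succ (hm : m < q) :
    W.bangLevel q b (m + 1) = W.bangLevel q b m + 1 / (exp 1 * W.μ (m + 1)) := by
  have : Finset.Ioc m q = insert (m + 1) (Finset.Ioc (m + 1) q) := by
    ext i; simp only [Finset.mem_Ioc, Finset.mem_insert]; omega
  unfold bangLevel
  rw [this, Finset.sum_insert (by simp)]
  ring

theorem abs_le_of_isBangSmall_succ (hD : W.IsBangChain q D x a b) (hm : m < q)
    (hsmall : ∀ t ∈ Icc a b, W.bangLevel q b (m + 1) ≤ t → W.IsBangSmall D x (m + 1) t)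
    (ht : t ∈ Icc a b) (hj : j ≤ m) (htx : t ≤ x j) :
    |D j t| ≤ exp ((j : ℝ) - (m + 1)) * W.M j *
      exp (exp 1 * W.μ (m + 1) * max (W.bangLevel q b (m + 1) - t) 0) := by
  rcases le_total (W.bangLevel q b (m + 1)) t with h | h
  · simpa [max_eq_right (sub_nonpos.2 h)] using hsmall t ht h j (by omega) htx
  · have hcb : W.bangLevel q b (m + 1) ≤ b := bangLevel_le
    rw [max_eq_left (sub_nonneg.2 h)]
    simpa [bangBound] using hD.abs_le_bangBound hm hcb
      (hsmall _ ⟨ht.1.trans h, hcb⟩ le_rfl) (by omega) ⟨ht.1, h⟩ htx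

theorem isBangSmall (hD : W.IsBangChain q D x a b) (hmq : m ≤ q) (ht : t ∈ Icc a b)
    (hmt : W.bangLevel q b m ≤ t) : W.IsBangSmall D x m t := by
  induction hmq using Nat.decreasingInduction generalizing t with
  | self =>
    intro j hj htx
    have hbt : b ≤ t := by simpa [bangLevel] using hmt
    rw [le_antisymm htx ((hD.mem_Icc j hj).2.trans hbt)]
    exact hD.abs_le_exp j hj
  | of_succ m hm ih =>
    intro j hj htx
    refine (hD.abs_le_of_isBangSmall_succ hm (fun s hs => ih hs) ht hj.le htx).trans ?_
    have hκ : 0 < exp 1 * W.μ (m + 1) := mul_pos (exp_pos 1) (W.μ_pos _ (by omega))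
    have hmax : max (W.bangLevel q b (m + 1) - t) 0 ≤ 1 / (exp 1 * W.μ (m + 1)) :=
      max_le (by rw [bangLevel_succ hm]; linarith) (by positivity)
    rw [le_div_iff₀' hκ] at hmax
    have := (W.M_pos j).le
    calc _ ≤ exp ((j : ℝ) - (m + 1)) * W.M j * exp 1 := by gcongr
      _ = exp ((j : ℝ) - m) * W.M j := by
        rw [mul_right_comm, ← exp_add]; congr 2; ring

/-- **Bang's lemma**: by the condition on the sum, the threshold of level `j₀` lies to the left of
`a`. -/
theorem abs_left_lt {j₀ : ℕ} (hD : W.IsBangChain q D x a b) (hj₀ : j₀ < q)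
    (hsum : exp 1 * (b - a) < ∑ i ∈ Finset.Ioc j₀ q, 1 / W.μ i) :
    |D 0 a| < exp (-(j₀ : ℝ)) * W.M0 := by
  have hx0 : x 0 ∈ Icc a b := hD.mem_Icc 0 (by omega)
  have hlevel : W.bangLevel q b j₀ < a := by
    have hsum' : b - a < ∑ i ∈ Finset.Ioc j₀ q, 1 / (exp 1 * W.μ i) := by
      simp only [one_div, mul_inv] at hsum ⊢
      rwa [← Finset.mul_sum, lt_inv_mul_iff₀ (exp_pos 1)]
    unfold bangLevel
    linarith
  refine (hD.abs_le_of_isBangSmall_succ hj₀ (fun s hs => hD.isBangSmall hj₀ hs)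
    (left_mem_Icc.2 (hx0.1.trans hx0.2)) j₀.zero_le hx0.1).trans_lt ?_
  have hκ : 0 < exp 1 * W.μ (j₀ + 1) := mul_pos (exp_pos 1) (W.μ_pos _ (by omega))
  have hmax : max (W.bangLevel q b (j₀ + 1) - a) 0 < 1 / (exp 1 * W.μ (j₀ + 1)) :=
    max_lt (by rw [bangLevel_succ hj₀]; linarith) (by positivity)
  rw [lt_div_iff₀' hκ] at hmax
  have := W.M0_pos
  rw [W.M_zero]
  calc _ < exp (((0 : ℕ) : ℝ) - (j₀ + 1)) * W.M0 * exp 1 := by gcongr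
    _ = exp (-(j₀ : ℝ)) * W.M0 := by
      rw [mul_right_comm, ← exp_add]; congr 2; push_cast; ring

end FullWeight.IsBangChain

end Bang

theorem exists_mem_lt_volume_inter_Ici {A : Set ℝ} (hbdd : BddBelow A) {m s : ℝ} (hm : 0 ≤ m)
    (hs : 0 < s) (hA : ENNReal.ofReal (m + s) < volume A) :
    ∃ y ∈ A, ENNReal.ofReal m < volume (A ∩ Ici (y + s)) := by
  obtain ⟨r, -, hmr, hrA⟩ := ENNReal.lt_iff_exists_real_btwn.1 hA
  rw [ENNReal.ofReal_lt_ofReal_iff_of_nonneg (by positivity)] at hmr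
  obtain ⟨y, hyA, hy⟩ := exists_lt_of_csInf_lt (nonempty_of_measure_ne_zero hA.ne_bot)
    (lt_add_of_pos_right (sInf A) (sub_pos.2 hmr))
  have hinf : sInf A ≤ y := csInf_le hbdd hyA
  refine ⟨y, hyA, ?_⟩
  by_contra! hcon
  have hcover : A ⊆ (A ∩ Ici (y + s)) ∪ Icc (sInf A) (y + s) := fun t ht =>
    (le_total (y + s) t).imp (fun h => ⟨ht, h⟩) fun h => ⟨csInf_le hbdd ht, h⟩
  have hle : volume A ≤ ENNReal.ofReal (m + (y + s - sInf A)) := by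
    rw [ENNReal.ofReal_add hm (by linarith), ← Real.volume_Icc]
    exact (measure_mono hcover).trans ((measure_union_le _ _).trans (by gcongr))
  have := (ENNReal.ofReal_lt_ofReal_iff_of_nonneg (by linarith)).1 (hrA.trans_le hle)
  linarith

/-- The points `z 0, …, z k` increase with gaps of length at least `s`. -/
def HasGaps (z : ℕ → ℝ) (s : ℝ) (k : ℕ) : Prop := ∀ i < k, z i + s ≤ z (i + 1)

theorem exists_hasGaps_of_lt_volume {A : Set ℝ} (hbdd : BddBelow A) {s : ℝ} (hs : 0 < s) (k : ℕ)
    (hA : ENNReal.ofReal (k * s) < volume A) :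
    ∃ z : ℕ → ℝ, (∀ i ≤ k, z i ∈ A) ∧ HasGaps z s k := by
  induction k generalizing A with
  | zero =>
    obtain ⟨y, hy⟩ := nonempty_of_measure_ne_zero hA.ne_bot
    exact ⟨fun _ => y, fun _ _ => hy, fun _ h => absurd h (Nat.not_lt_zero _)⟩
  | succ k ih =>
    rw [Nat.cast_succ, add_one_mul] at hA
    obtain ⟨y, hyA, hy⟩ := exists_mem_lt_volume_inter_Ici hbdd (by positivity) hs hA
    obtain ⟨z, hzA, hz⟩ := ih (hbdd.mono inter_subset_left) hy
    refine ⟨fun i => Nat.casesOn i y z, ?_, ?_⟩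
    · rintro (_ | i) hi
      · exact hyA
      · exact (hzA i (by omega)).1
    · rintro (_ | i) hi
      · exact (hzA 0 (by omega)).2
      · exact hz i (by omega)

namespace HasGaps

variable {z : ℕ → ℝ} {s : ℝ} {k : ℕ}

theorem mul_le_sub (hz : HasGaps z s k) {i m : ℕ} (h : i + m ≤ k) : m * s ≤ z (i + m) - z i := by
  induction m with
  | zero => simp
  | succ m ih =>
    have := ih (by omega)
    have := hz (i + m) (by omega)
    push_cast
    rw [← add_assoc]
    linarith

theorem injOn (hz : HasGaps z s k) (hs : 0 < s) : InjOn z (Finset.range (k + 1)) := by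
  have hmono : StrictMonoOn z (Iic k) :=
    strictMonoOn_of_lt_add_one ordConnected_Iic fun i _ _ hi => by
      have := hz i (by simpa [Nat.succ_le_iff] using hi)
      linarith
  simpa [Nat.lt_succ_iff, ← Iio_add_one_eq_Iic] using hmono.injOn

theorem factorial_mul_pow_le_prod_left (hz : HasGaps z s k) (hs : 0 < s) {i : ℕ} (hi : i ≤ k) :
    i.factorial * s ^ i ≤ ∏ j ∈ Finset.range i, |z i - z j| := by
  rw [← Finset.prod_range_reflect, ← Finset.prod_range_add_one_eq_factorial, Nat.cast_prod,
    ← Finset.card_range i, ← Finset.prod_const, Finset.card_range, ← Finset.prod_mul_distrib]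
  refine Finset.prod_le_prod (fun j _ => by positivity) fun j hj => ?_
  rw [Finset.mem_range] at hj
  have h := hz.mul_le_sub (i := i - 1 - j) (m := j + 1) (by omega)
  rw [show i - 1 - j + (j + 1) = i by omega] at h
  exact h.trans (le_abs_self _)

theorem factorial_mul_pow_le_prod_right (hz : HasGaps z s k) (hs : 0 < s) (i : ℕ) :
    (k - i).factorial * s ^ (k - i) ≤ ∏ j ∈ Finset.Ioc i k, |z i - z j| := by
  rw [← Finset.Ico_add_one_add_one_eq_Ioc, Finset.prod_Ico_eq_prod_range, Nat.add_sub_add_right,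
    ← Finset.prod_range_add_one_eq_factorial, Nat.cast_prod,
    ← Finset.card_range (k - i), ← Finset.prod_const, Finset.card_range,
    ← Finset.prod_mul_distrib]
  refine Finset.prod_le_prod (fun j _ => by positivity) fun j hj => ?_
  rw [Finset.mem_range] at hj
  have h := hz.mul_le_sub (i := i) (m := j + 1) (by omega)
  rw [abs_sub_comm, add_assoc, add_comm 1 j]
  exact h.trans (le_abs_self _)

theorem factorial_mul_pow_le_prod_erase (hz : HasGaps z s k) (hs : 0 < s) {i : ℕ} (hi : i ≤ k) :
    i.factorial * (k - i).factorial * s ^ k ≤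
      ∏ j ∈ (Finset.range (k + 1)).erase i, |z i - z j| := by
  have hsplit : (Finset.range (k + 1)).erase i = Finset.range i ∪ Finset.Ioc i k := by
    ext j; simp only [Finset.mem_erase, Finset.mem_range, Finset.mem_union, Finset.mem_Ioc]; omega
  have hdisj : Disjoint (Finset.range i) (Finset.Ioc i k) :=
    Finset.disjoint_left.2 fun j => by simp only [Finset.mem_range, Finset.mem_Ioc]; omega
  rw [hsplit, Finset.prod_union hdisj]
  calc (i.factorial * (k - i).factorial * s ^ k : ℝ)
      = (i.factorial * s ^ i) * ((k - i).factorial * s ^ (k - i)) := by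
        rw [← pow_mul_pow_sub s hi]; ring
    _ ≤ _ := by
      gcongr
      exacts [hz.factorial_mul_pow_le_prod_left hs hi, hz.factorial_mul_pow_le_prod_right hs i]

end HasGaps

theorem abs_sum_powersetCard_prod_le {ι : Type*} {u : Finset ι} {g : ι → ℝ} {c : ℝ}
    (hg : ∀ i ∈ u, |g i| ≤ c) (m : ℕ) :
    |∑ T ∈ u.powersetCard m, ∏ i ∈ T, g i| ≤ (u.card.choose m : ℝ) * c ^ m := by
  rw [← Finset.card_powersetCard, ← nsmul_eq_mul]
  refine (Finset.abs_sum_le_sum_abs _ _).trans (Finset.sum_le_card_nsmul _ _ _ fun T hT => ?_)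
  obtain ⟨hTu, rfl⟩ := Finset.mem_powersetCard.1 hT
  rw [Finset.abs_prod, ← Finset.prod_const]
  exact Finset.prod_le_prod (fun _ _ => abs_nonneg _) fun i hi => hg i (hTu hi)

theorem HasGaps.abs_div_prod_mul_sum_le {z : ℕ → ℝ} {s v ε a b t : ℝ} {r k i : ℕ}
    (hz : HasGaps z s r) (hs : 0 < s) (hzI : ∀ i ≤ r, z i ∈ Icc a b) (hv : |v| ≤ ε) (hk : k ≤ r)
    (ht : t ∈ Icc a b) (hi : i ∈ Finset.range (r + 1)) :
    |(v / ∏ j ∈ (Finset.range (r + 1)).erase i, (z i - z j)) *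
        ∑ T ∈ ((Finset.range (r + 1)).erase i).powersetCard (r - k), ∏ j ∈ T, (t - z j)| ≤
      ε / (i.factorial * (r - i).factorial * s ^ r) * (r.choose k * (b - a) ^ (r - k)) := by
  have hε : 0 ≤ ε := (abs_nonneg _).trans hv
  have hdist : ∀ j ∈ (Finset.range (r + 1)).erase i, |t - z j| ≤ b - a := fun j hj => by
    have hzj := hzI j (Nat.lt_succ_iff.1 (Finset.mem_range.1 (Finset.mem_of_mem_erase hj)))
    exact abs_sub_le_of_le_of_le ht.1 ht.2 hzj.1 hzj.2
  have hsum := abs_sum_powersetCard_prod_le hdist (r - k)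
  rw [Finset.card_erase_of_mem hi, Finset.card_range, Nat.add_sub_cancel,
    Nat.choose_symm hk] at hsum
  rw [abs_mul, abs_div, Finset.abs_prod]
  gcongr
  exact hz.factorial_mul_pow_le_prod_erase hs (Nat.lt_succ_iff.1 (Finset.mem_range.1 hi))

open Polynomial in
theorem HasGaps.abs_eval_iterate_derivative_le {z : ℕ → ℝ} {s ε a b t : ℝ} {r k : ℕ} {P : ℝ[X]}
    (hz : HasGaps z s r) (hs : 0 < s) (hzI : ∀ i ≤ r, z i ∈ Icc a b) (hP : P.degree < (r + 1 : ℕ))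
    (hPε : ∀ i ≤ r, |P.eval (z i)| ≤ ε) (hk : k ≤ r) (ht : t ∈ Icc a b) :
    |(derivative^[k] P).eval t| ≤ ε * (2 / s) ^ r * (b - a) ^ (r - k) / (r - k).factorial := by
  have hchoose : ∀ i ∈ Finset.range (r + 1),
      ε / (i.factorial * (r - i).factorial * s ^ r) * (r.choose k * (b - a) ^ (r - k)) =
        (r.choose i : ℝ) * (ε / (r.factorial * s ^ r) * (r.choose k * (b - a) ^ (r - k))) := by
    intro i hi
    rw [Finset.mem_range, Nat.lt_succ_iff] at hi
    rw [← Nat.choose_mul_factorial_mul_factorial hi]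
    have := (Nat.choose_pos hi).ne'
    push_cast
    field_simp
  rw [Lagrange.eval_iterate_derivative_eq_sum (hz.injOn hs) (by simpa using hP)
    (by simpa [Nat.lt_succ_iff] using hk), abs_mul, Nat.abs_cast, Finset.card_range,
    Nat.add_sub_add_right]
  calc _ ≤ (k.factorial : ℝ) * ∑ i ∈ Finset.range (r + 1),
        ε / (i.factorial * (r - i).factorial * s ^ r) * (r.choose k * (b - a) ^ (r - k)) := by
        gcongr
        refine (Finset.abs_sum_le_sum_abs _ _).trans (Finset.sum_le_sum fun i hi => ?_)
        exact hz.abs_div_prod_mul_sum_le hs hzI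
          (hPε i (Nat.lt_succ_iff.1 (Finset.mem_range.1 hi))) hk ht hi
    _ = k.factorial * (2 ^ r *
          (ε / (r.factorial * s ^ r) * (r.choose k * (b - a) ^ (r - k)))) := by
        rw [Finset.sum_congr rfl hchoose, ← Finset.sum_mul, ← Nat.cast_sum, Nat.sum_range_choose]
        push_cast; rfl
    _ = _ := by
        have := (Nat.choose_pos hk).ne'
        rw [← Nat.choose_mul_factorial_mul_factorial hk, div_pow]
        push_cast
        field_simp

namespace FullWeight

open Polynomial in
/-- The difference of `D 0` and its interpolation polynomial vanishes at the nodes, so iterating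
Rolle's theorem yields points at which the derivatives of both coincide. -/
theorem IsSmoothChain.exists_isBangChain {W : FullWeight} {r : ℕ} {D : ℕ → ℝ → ℝ} {a b s ε : ℝ}
    {z : ℕ → ℝ} (hD : W.IsSmoothChain (r + 1) D (Icc a b)) (hz : HasGaps z s r) (hs : 0 < s)
    (hzI : ∀ i ≤ r, z i ∈ Icc a b) (hε : ∀ i ≤ r, |D 0 (z i)| ≤ ε)
    (hsmall : ∀ j ≤ r, ε * (2 / s) ^ r * (b - a) ^ (r - j) / (r - j).factorial ≤
      exp ((j : ℝ) - (r + 1 : ℕ)) * W.M j) :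
    ∃ x, W.IsBangChain (r + 1) D x a (z r) := by
  set P := Lagrange.interpolate (Finset.range (r + 1)) z fun i => D 0 (z i)
  have hPz : ∀ i ≤ r, P.eval (z i) = D 0 (z i) := fun i hi =>
    Lagrange.eval_interpolate_at_node _ (hz.injOn hs) (Finset.mem_range.2 (by omega))
  have hPdeg : P.degree < (r + 1 : ℕ) :=
    (Lagrange.degree_interpolate_lt _ (hz.injOn hs)).trans_eq (by rw [Finset.card_range])
  obtain ⟨x, -, hxm, hxI, hx⟩ := exists_monotone_zeros_of_hasDerivAt ordConnected_Icc r
    (fun j t => D j t - (derivative^[j] P).eval t) z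
    (fun j hj t ht => by
      rw [Function.iterate_succ_apply']
      exact (hD.hasDerivAt j (by omega) t ht).sub (Polynomial.hasDerivAt _ t))
    (fun i hi => by linarith [hz i hi]) hzI
    (fun i hi => by simp [hPz i hi])
  have hzr : Icc a (z r) ⊆ Icc a b := Icc_subset_Icc_right (hzI r le_rfl).2
  have hxa : ∀ j ≤ r, x j ∈ Icc a (z r) := fun j hj =>
    Icc_subset_Icc_left (hzI 0 r.zero_le).1 (hxI j hj)
  refine ⟨x, hD.mono (fun _ _ => le_rfl) hzr, fun j hj => hxm j (by omega),
    fun j hj => hxa j (by omega), fun j hj => ?_⟩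
  rw [sub_eq_zero.1 (hx j (by omega))]
  exact (hz.abs_eval_iterate_derivative_le hs hzI hPdeg
    (fun i hi => (congrArg abs (hPz i hi)).trans_le (hε i hi)) (by omega)
    (hzr (hxa j (by omega)))).trans (hsmall j (by omega))

theorem IsSmoothChain.abs_left_lt_of_small_on {W : FullWeight} {r j₀ : ℕ} {D : ℕ → ℝ → ℝ}
    {a b s ε : ℝ} {A : Set ℝ} (hD : W.IsSmoothChain (r + 1) D (Icc a b)) (hj₀ : j₀ < r + 1)
    (hsum : exp 1 * (b - a) ≤ ∑ i ∈ Finset.Ioc j₀ (r + 1), 1 / W.μ i) (hA : A ⊆ Ico a b)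
    (hs : 0 < s) (hAs : ENNReal.ofReal (r * s) < volume A) (hε : ∀ t ∈ A, |D 0 t| ≤ ε)
    (hsmall : ∀ j ≤ r, ε * (2 / s) ^ r * (b - a) ^ (r - j) / (r - j).factorial ≤
      exp ((j : ℝ) - (r + 1 : ℕ)) * W.M j) :
    |D 0 a| < exp (-(j₀ : ℝ)) * W.M0 := by
  obtain ⟨z, hzA, hz⟩ := exists_hasGaps_of_lt_volume ⟨a, fun t ht => (hA ht).1⟩ hs r hAs
  obtain ⟨x, hx⟩ := hD.exists_isBangChain hz hs (fun i hi => Ico_subset_Icc_self (hA (hzA i hi)))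
    (fun i hi => hε _ (hzA i hi)) hsmall
  refine hx.abs_left_lt hj₀ (lt_of_lt_of_le ?_ hsum)
  gcongr
  exact (hA (hzA r le_rfl)).2

/-- `W.μ` grows on `{1, …, q}` at most like the power `i ^ γ`, relative to its value at `q`: the
discrete form of the condition `s μ̃'(s) / μ̃(s) ≤ γ`. -/
def HasGrowthExponent (W : FullWeight) (γ : ℝ) (q : ℕ) : Prop :=
  ∀ i : ℕ, 1 ≤ i → i ≤ q → W.μ q * ((i : ℝ) / q) ^ γ ≤ W.μ i

theorem HasGrowthExponent.pow_mul_exp_le_prod {W : FullWeight} {γ c : ℝ} {q j : ℕ}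
    (hW : W.HasGrowthExponent γ q) (hγ : 0 ≤ γ) (hq : 1 ≤ q) (hc : 0 ≤ c) (hcq : c ≤ W.μ q)
    (hj : j ≤ q) : c ^ j * exp (-(γ * q)) ≤ ∏ i ∈ Finset.Icc 1 j, W.μ i := by
  have hfact : exp (-(q : ℝ)) ≤ (j.factorial : ℝ) / q ^ j := by
    rw [exp_neg, ← inv_div]
    gcongr
    exact pow_div_factorial_le_exp _ q.cast_nonneg j
  calc c ^ j * exp (-(γ * q)) = c ^ j * exp (-(q : ℝ)) ^ γ := by
        rw [← exp_mul, neg_mul, mul_comm γ]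
    _ ≤ c ^ j * ((j.factorial : ℝ) / q ^ j) ^ γ := by gcongr
    _ = ∏ i ∈ Finset.Icc 1 j, (c * ((i : ℝ) / q) ^ γ) := by
        rw [Finset.prod_mul_distrib, finsetProd_rpow _ _ (fun i _ => by positivity),
          Finset.prod_div_distrib, Finset.prod_const, Finset.prod_const, Nat.card_Icc,
          Nat.add_sub_cancel, ← Nat.cast_prod, ← Finset.Ico_add_one_right_eq_Icc,
          Finset.prod_Ico_id_eq_factorial]
    _ ≤ ∏ i ∈ Finset.Icc 1 j, W.μ i := by
        refine Finset.prod_le_prod (fun i _ => by positivity) fun i hi => ?_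
        obtain ⟨h1, hij⟩ := Finset.mem_Icc.1 hi
        exact (mul_le_mul_of_nonneg_right hcq (by positivity)).trans (hW i h1 (hij.trans hj))

/-- If `W.μ q` is too small for the lower bound on `V.M`, the constant `c` for which the sum
condition holds with equality is a majorant of `W.μ`. -/
theorem HasGrowthExponent.exists_majorant {W : FullWeight} {γ l : ℝ} {q j₀ : ℕ}
    (hW : W.HasGrowthExponent γ q) (hγ : 0 ≤ γ) (hq : 1 ≤ q) (hj₀ : 2 * j₀ ≤ q) (hl : 0 < l)
    (hsum : exp 1 * l ≤ ∑ i ∈ Finset.Ioc j₀ q, 1 / W.μ i) :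
    ∃ V : FullWeight, V.M0 = W.M0 ∧ (∀ i, 1 ≤ i → i ≤ q → W.μ i ≤ V.μ i) ∧
      exp 1 * l ≤ ∑ i ∈ Finset.Ioc j₀ q, 1 / V.μ i ∧
      ∀ j ≤ q, W.M0 * ((q / (2 * exp 1 * l)) ^ j * exp (-(γ * q))) ≤ V.M j := by
  set c : ℝ := (q - j₀) / (exp 1 * l) with hc
  have hq' : (1 : ℝ) ≤ q := by exact_mod_cast hq
  have hj₀' : 2 * (j₀ : ℝ) ≤ q := by exact_mod_cast hj₀
  have hqc : q / (2 * exp 1 * l) ≤ c := by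
    rw [hc, mul_assoc, ← div_div]
    gcongr
    linarith
  have hcpos : 0 < c := lt_of_lt_of_le (by positivity) hqc
  have hM0 := W.M0_pos.le
  rcases le_or_gt c (W.μ q) with h | h
  · refine ⟨W, rfl, fun _ _ _ => le_rfl, hsum, fun j hj => mul_le_mul_of_nonneg_left ?_ hM0⟩
    exact hW.pow_mul_exp_le_prod hγ hq (by positivity) (hqc.trans h) hj
  · refine ⟨⟨fun _ => c, W.M0, fun _ _ => hcpos, fun _ _ _ _ => le_rfl, W.M0_pos⟩, rfl,
      fun i h1 hi => (W.μ_mono i q h1 hi).trans h.le, le_of_eq ?_,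
      fun j _ => mul_le_mul_of_nonneg_left ?_ hM0⟩
    · have : (q : ℝ) - j₀ ≠ 0 := by linarith
      simp only [Finset.sum_const]
      rw [Nat.card_Ioc, nsmul_eq_mul, Nat.cast_sub (by omega), hc]
      field_simp
    · rw [Finset.prod_const, Nat.card_Icc, Nat.add_sub_cancel]
      exact mul_le_of_le_one_right (by positivity) (exp_le_one_iff.2 (neg_nonpos.2 (by positivity)))
        |>.trans (pow_le_pow_left₀ (by positivity) hqc j)

end FullWeight

/-- The left-hand side bounds the derivatives of the interpolation polynomial with nodes at
distance `m / (r + 1)`; the estimate comes from `(r + 1) ^ k / k! ≤ exp (r + 1)`. -/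
theorem interpolation_bound_le {l m ε γ : ℝ} {r j : ℕ} (hm : 0 < m) (hml : m ≤ l) (hε : 0 ≤ ε)
    (hj : j ≤ r) :
    ε * (2 / (m / (r + 1 : ℕ))) ^ r * l ^ (r - j) / (r - j).factorial ≤
      exp ((j : ℝ) - (r + 1 : ℕ)) * ((4 * exp (2 + γ) * l / m) ^ (r + 1) * ε *
        (((r + 1 : ℕ) / (2 * exp 1 * l)) ^ j * exp (-(γ * (r + 1 : ℕ))))) := by
  obtain ⟨k, rfl⟩ := Nat.exists_eq_add_of_le hj
  have hl : 0 < l := hm.trans_le hml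
  set q : ℕ := j + k + 1
  have hq : (0 : ℝ) < q := by positivity
  have hexp : exp ((j : ℝ) - q) * exp (2 + γ) ^ q * exp (-(γ * q)) = exp 1 ^ j * exp q := by
    rw [← exp_nat_mul, ← exp_nat_mul, ← exp_add, ← exp_add, ← exp_add]
    congr 1; ring
  have htwo : (2 : ℝ) ^ (j + k) ≤ 4 ^ q / 2 ^ j := by
    rw [le_div_iff₀ (by positivity), ← pow_add, show (4 : ℝ) = 2 ^ 2 by norm_num, ← pow_mul]
    exact pow_le_pow_right₀ one_le_two (by omega)
  rw [Nat.add_sub_cancel_left]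
  calc ε * (2 / (m / q)) ^ (j + k) * l ^ k / k.factorial
      = ε * (q / l) ^ j * 2 ^ (j + k) * (l / m) ^ (j + k) * (q ^ k / k.factorial) := by
        simp only [pow_add, div_pow]; field_simp
    _ ≤ ε * (q / l) ^ j * (4 ^ q / 2 ^ j) * (l / m) ^ q * exp q := by
        gcongr
        · exact (one_le_div₀ hm).2 hml
        · exact Nat.le_succ _
        · exact pow_div_factorial_le_exp _ hq.le k
    _ = (ε * (q / l) ^ j * (4 ^ q / 2 ^ j) * (l / m) ^ q / exp 1 ^ j) * (exp 1 ^ j * exp q) := by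
        field_simp
    _ = _ := by
        rw [← hexp]; simp only [div_pow, mul_pow]; field_simp

/-- If the bound failed, `ε` would be so small that Bang's argument forces
`|D 0 a| < e^{-j₀} M_0`. -/
theorem FullWeight.IsSmoothChain.abs_left_le {W : FullWeight} {q j₀ : ℕ} {D : ℕ → ℝ → ℝ}
    {a b m ε γ : ℝ} {A : Set ℝ} (hD : W.IsSmoothChain q D (Icc a b)) (hq : 1 ≤ q)
    (hj₀ : 2 * j₀ ≤ q) (hsum : exp 1 * (b - a) ≤ ∑ i ∈ Finset.Ioc j₀ q, 1 / W.μ i) (hγ : 0 ≤ γ)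
    (hW : W.HasGrowthExponent γ q) (ha : exp (-(j₀ : ℝ)) * W.M0 ≤ |D 0 a|) (hA : A ⊆ Ico a b)
    (hm : 0 < m) (hAm : ENNReal.ofReal m ≤ volume A) (hε : ∀ t ∈ A, |D 0 t| ≤ ε) :
    |D 0 a| ≤ (4 * exp (2 + γ) * (b - a) / m) ^ q * ε := by
  obtain ⟨y, hyA⟩ : A.Nonempty :=
    nonempty_of_measure_ne_zero ((ENNReal.ofReal_pos.2 hm).trans_le hAm).ne'
  have hε0 : 0 ≤ ε := (abs_nonneg _).trans (hε y hyA)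
  have hab : a < b := (hA hyA).1.trans_lt (hA hyA).2
  have hmb : m ≤ b - a := by
    rw [← ENNReal.ofReal_le_ofReal_iff (sub_pos.2 hab).le, ← Real.volume_Ico]
    exact hAm.trans (measure_mono hA)
  obtain ⟨V, hV0, hWV, hVsum, hVM⟩ := hW.exists_majorant hγ hq hj₀ (sub_pos.2 hab) hsum
  by_contra! hlt
  have hM0 : (4 * exp (2 + γ) * (b - a) / m) ^ q * ε ≤ W.M0 :=
    hlt.le.trans (W.M_zero ▸ hD.abs_le 0 q.zero_le a (left_mem_Icc.2 hab.le))
  obtain ⟨r, rfl⟩ := Nat.exists_eq_add_of_le' hq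
  refine absurd ha (not_le.2 ?_)
  rw [← hV0]
  refine (hD.mono (fun j => M_le_M hV0.symm hWV) Subset.rfl).abs_left_lt_of_small_on (by omega)
    hVsum hA (s := m / (r + 1 : ℕ)) (by positivity) (lt_of_lt_of_le ?_ hAm) hε fun j hj => ?_
  · rw [ENNReal.ofReal_lt_ofReal_iff hm, mul_div_assoc', div_lt_iff₀ (by positivity)]
    push_cast
    linarith
  · refine (interpolation_bound_le (γ := γ) hm hmb hε0 hj).trans ?_
    have := hVM j (by omega)
    gcongr
    exact le_trans (by gcongr) this

section SymmetricDerivative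

variable {E F : Type*} [NormedAddCommGroup E] [NormedSpace ℝ E] [NormedAddCommGroup F]
  [NormedSpace ℝ F] {f : E → F} {x : E} {j : ℕ}

theorem iteratedFDeriv_add_two_apply (w : Fin (j + 2) → E) :
    iteratedFDeriv ℝ (j + 2) f x w =
      fderiv ℝ (fderiv ℝ (iteratedFDeriv ℝ j f)) x (w 0) (w 1) (Fin.tail (Fin.tail w)) := by
  have h := LinearIsometryEquiv.comp_fderiv (𝕜 := ℝ) (G := E)
    (iso := (continuousMultilinearCurryLeftEquiv ℝ (fun _ : Fin (j + 1) => E) F).symm)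
    (f := fderiv ℝ (iteratedFDeriv ℝ j f)) (x := x)
  rw [iteratedFDeriv_succ_apply_left, iteratedFDeriv_succ_eq_comp_left]
  exact congrArg (fun T => T (w 0) (Fin.tail w)) h

theorem iteratedFDeriv_comp_swap_zero_one (hf : ContDiffAt ℝ (j + 2 : ℕ) f x)
    (w : Fin (j + 2) → E) :
    iteratedFDeriv ℝ (j + 2) f x (w ∘ Equiv.swap 0 1) = iteratedFDeriv ℝ (j + 2) f x w := by
  have hsymm : IsSymmSndFDerivAt ℝ (iteratedFDeriv ℝ j f) x :=
    (hf.iteratedFDeriv_right (m := 2) (by norm_cast; omega)).isSymmSndFDerivAt (by simp)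
  have htail : Fin.tail (Fin.tail (w ∘ Equiv.swap 0 1)) = Fin.tail (Fin.tail w) :=
    funext fun k => congrArg w (Equiv.swap_apply_of_ne_of_ne (by simp) (by simp [Fin.ext_iff]))
  rw [iteratedFDeriv_add_two_apply, iteratedFDeriv_add_two_apply, htail, hsymm.eq]
  simp

theorem iteratedFDeriv_succ_congr (hf : DifferentiableAt ℝ (iteratedFDeriv ℝ j f) x)
    {w w' : Fin (j + 1) → E} (h0 : w 0 = w' 0)
    (h : ∀ᶠ y in 𝓝 x, iteratedFDeriv ℝ j f y (Fin.tail w) =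
      iteratedFDeriv ℝ j f y (Fin.tail w')) :
    iteratedFDeriv ℝ (j + 1) f x w = iteratedFDeriv ℝ (j + 1) f x w' := by
  rw [iteratedFDeriv_succ_apply_left, iteratedFDeriv_succ_apply_left, h0,
    ← fderiv_continuousMultilinear_apply_const_apply hf,
    ← fderiv_continuousMultilinear_apply_const_apply hf, Filter.EventuallyEq.fderiv_eq h]

/-- Adjacent transpositions generate the symmetric group; one not moving the first argument is
dealt with by induction. -/
theorem iteratedFDeriv_comp_perm (hf : ContDiffAt ℝ j f x) (w : Fin j → E)
    (σ : Equiv.Perm (Fin j)) :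
    iteratedFDeriv ℝ j f x (w ∘ σ) = iteratedFDeriv ℝ j f x w := by
  induction j generalizing x with
  | zero => exact congrArg _ (Subsingleton.elim _ _)
  | succ j ih =>
    have hdiff : DifferentiableAt ℝ (iteratedFDeriv ℝ j f) x :=
      hf.differentiableAt_iteratedFDeriv (by exact_mod_cast j.lt_succ_self)
    have hev : ∀ᶠ y in 𝓝 x, ContDiffAt ℝ j f y :=
      (hf.of_le (by exact_mod_cast j.le_succ)).eventually (by simp)
    have hmem : σ ∈ Submonoid.closure (range fun i : Fin j => Equiv.swap i.castSucc i.succ) := by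
      rw [Equiv.Perm.mclosure_swap_castSucc_succ]; trivial
    induction hmem using Submonoid.closure_induction generalizing w with
    | one => rfl
    | mul σ τ _ _ hσ hτ => rw [Equiv.Perm.coe_mul, ← Function.comp_assoc, hτ, hσ]
    | mem σ hσ =>
      obtain ⟨i, rfl⟩ := hσ
      cases j with
      | zero => exact i.elim0
      | succ j =>
        cases i using Fin.cases with
        | zero => exact iteratedFDeriv_comp_swap_zero_one hf w
        | succ i =>
          refine iteratedFDeriv_succ_congr hdiff (congrArg w (Equiv.swap_apply_of_ne_of_ne
            (by simp [Fin.ext_iff]) (by simp [Fin.ext_iff]))) (hev.mono fun y hy => ?_)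
          rw [← ih hy (Fin.tail w) (Equiv.swap i.castSucc i.succ)]
          congr 1
          funext k
          simp only [Fin.tail, Function.comp_apply]
          rw [← Fin.succ_castSucc, (Fin.succ_injective _).map_swap]

theorem hasDerivAt_iteratedFDeriv_line {n : ℕ} {v : E} {t : ℝ}
    (hf : ContDiffAt ℝ n f (x + t • v)) (hj : j < n) :
    HasDerivAt (fun s : ℝ => iteratedFDeriv ℝ j f (x + s • v) fun _ => v)
      (iteratedFDeriv ℝ (j + 1) f (x + t • v) fun _ => v) t := by
  have hline : HasDerivAt (fun s : ℝ => x + s • v) v t := by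
    simpa using ((hasDerivAt_id t).smul_const v).const_add x
  have hjf := (hf.differentiableAt_iteratedFDeriv (by exact_mod_cast hj)).hasFDerivAt
  exact (ContinuousMultilinearMap.apply ℝ (fun _ : Fin j => E) F
    (fun _ => v)).hasFDerivAt.comp_hasDerivAt t (hjf.comp_hasDerivAt t hline)

theorem continuousAt_iteratedFDeriv_apply (hf : ContDiffAt ℝ j f x) (w : Fin j → E) :
    ContinuousAt (fun y => iteratedFDeriv ℝ j f y w) x :=
  (ContinuousMultilinearMap.apply ℝ (fun _ : Fin j => E) F w).continuous.continuousAt.comp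
    (hf.iteratedFDeriv_right (m := 0) (by simp)).continuousAt

end SymmetricDerivative

section Words

variable {κ ι : Type*} [Fintype κ] [DecidableEq ι]

/-- The content of a word `p` with letters in `ι`: how often each letter occurs. Words of content
`α` index the partial derivatives, taken in some order, that are equal to `f^{(α)}`. -/
def wordContent (p : κ → ι) (i : ι) : ℕ := (Finset.univ.filter fun k => p k = i).card

theorem exists_perm_of_wordContent_eq {p p' : κ → ι} (h : wordContent p = wordContent p') :
    ∃ σ : Equiv.Perm κ, p' ∘ σ = p := by
  have e : ∀ i, {k // p k = i} ≃ {k // p' k = i} := fun i =>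
    Fintype.equivOfCardEq (by simpa [wordContent, Fintype.card_subtype] using congrFun h i)
  exact ⟨Equiv.ofFiberEquiv e, funext fun a => Equiv.ofFiberEquiv_map e a⟩

variable [Fintype ι]

theorem sum_wordContent (p : κ → ι) : ∑ i, wordContent p i = Fintype.card κ :=
  (Finset.card_eq_sum_card_fiberwise fun _ _ => Finset.mem_univ _).symm

theorem wordContent_finSigmaFinEquiv {d : ℕ} (α : Fin d → ℕ) :
    wordContent (fun k => (finSigmaFinEquiv (n := α).symm k).1) = α := by
  funext i
  have e : {k // (finSigmaFinEquiv (n := α).symm k).1 = i} ≃ Fin (α i) :=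
    (finSigmaFinEquiv.symm.subtypeEquiv (q := fun s => s.1 = i) fun _ => Iff.rfl).trans
      (Equiv.sigmaSubtype i)
  rw [wordContent, ← Fintype.card_subtype, Fintype.card_congr e, Fintype.card_fin]

open MvPolynomial in
/-- Compare the coefficients of `X ^ α` in the two expansions of `(∑ i, X i) ^ j`. -/
theorem card_wordContent_eq {j : ℕ} {α : ι → ℕ} (hα : ∑ i, α i = j) :
    (Finset.univ.filter fun p : Fin j → ι => wordContent p = α).card =
      Nat.multinomial Finset.univ α := by
  have hmonomial : ∀ β : ι → ℕ, ∏ i, (X i : MvPolynomial ι ℕ) ^ β i =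
      monomial (Finsupp.equivFunOnFinite.symm β) 1 := fun β => by
    rw [monomial_eq, Finsupp.prod_fintype _ _ (by simp)]
    simp
  have hword : ∀ p : Fin j → ι, ∏ k, (X (p k) : MvPolynomial ι ℕ) =
      monomial (Finsupp.equivFunOnFinite.symm (wordContent p)) 1 := fun p => by
    rw [← hmonomial, ← Finset.prod_fiberwise' Finset.univ p X]
    simp [wordContent]
  have hpow :=
    (Finset.sum_pow_eq_sum_piAntidiag Finset.univ (X : ι → MvPolynomial ι ℕ) j).symm.trans
      (Fintype.sum_pow X j)
  simp only [hword, hmonomial] at hpow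
  have hcoeff := congrArg (coeff (Finsupp.equivFunOnFinite.symm α)) hpow
  simp only [← nsmul_eq_mul, coeff_sum, coeff_smul, coeff_monomial,
    EmbeddingLike.apply_eq_iff_eq] at hcoeff
  rw [Finset.card_filter, ← hcoeff, Finset.sum_eq_single_of_mem α (by simp [hα])
    fun β _ hβ => by rw [if_neg hβ, smul_zero]]
  simp

end Words

section DerivNorm

variable {d j : ℕ}

theorem abs_map_const_le_sum_single {ι : Type*} [Fintype ι] [DecidableEq ι]
    (T : EuclideanSpace ℝ ι [×j]→L[ℝ] ℝ) {v : EuclideanSpace ℝ ι} (hv : ‖v‖ ≤ 1) :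
    |T fun _ => v| ≤ ∑ p : Fin j → ι, |T fun k => EuclideanSpace.single (p k) (1 : ℝ)| := by
  have hsum : v = ∑ i, v i • EuclideanSpace.single i (1 : ℝ) := by
    ext k
    simp [Pi.single_apply]
  conv_lhs => rw [hsum]
  rw [ContinuousMultilinearMap.map_sum]
  refine (Finset.abs_sum_le_sum_abs _ _).trans (Finset.sum_le_sum fun p _ => ?_)
  rw [ContinuousMultilinearMap.map_smul_univ, smul_eq_mul, abs_mul, Finset.abs_prod]
  exact mul_le_of_le_one_left (abs_nonneg _)
    (Finset.prod_le_one (fun _ _ => abs_nonneg _) fun k _ => (PiLp.norm_apply_le v _).trans hv)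

variable {f : EuclideanSpace ℝ (Fin d) → ℝ} {x : EuclideanSpace ℝ (Fin d)}

theorem partialDeriv_eq_of_wordContent {α : Fin d → ℕ} {p : Fin (∑ i, α i) → Fin d}
    (hp : wordContent p = α) (hf : ContDiffAt ℝ (∑ i, α i : ℕ) f x) :
    partialDeriv α f x =
      iteratedFDeriv ℝ (∑ i, α i) f x fun k => EuclideanSpace.single (p k) (1 : ℝ) := by
  obtain ⟨σ, hσ⟩ :=
    exists_perm_of_wordContent_eq (hp.trans (wordContent_finSigmaFinEquiv α).symm)
  subst hσ
  exact (iteratedFDeriv_comp_perm hf _ σ).symm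

theorem abs_partialDeriv_le_supNorm {K : Set (EuclideanSpace ℝ (Fin d))} (hK : IsCompact K)
    {α : Fin d → ℕ} (hf : ∀ y ∈ K, ContDiffAt ℝ (∑ i, α i : ℕ) f y) (hx : x ∈ K) :
    |partialDeriv α f x| ≤ supNorm (partialDeriv α f) K :=
  le_csSup (hK.image_of_continuousOn fun y hy =>
    (continuousAt_iteratedFDeriv_apply (hf y hy) _).abs.continuousWithinAt).bddAbove ⟨x, hx, rfl⟩

/-- The words of content `α` all give the same derivative `f^{(α)}`, and their number is the weight
`j! / α!` of `f^{(α)}` in `derivNorm`. -/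
theorem abs_iteratedFDeriv_le_derivNorm {K : Set (EuclideanSpace ℝ (Fin d))} (hK : IsCompact K)
    (hf : ∀ y ∈ K, ContDiffAt ℝ j f y) (hx : x ∈ K) {v : EuclideanSpace ℝ (Fin d)} (hv : ‖v‖ ≤ 1) :
    |iteratedFDeriv ℝ j f x fun _ => v| ≤ derivNorm j f K := by
  classical
  refine (abs_map_const_le_sum_single _ hv).trans ?_
  rw [← Finset.sum_fiberwise_of_maps_to (t := Finset.piAntidiag (Finset.univ : Finset (Fin d)) j)
    (g := wordContent) fun p _ => by simp [sum_wordContent]]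
  refine Finset.sum_le_sum fun α hα => ?_
  obtain rfl : ∑ i, α i = j := by simpa using hα
  have hmult : ((∑ i, α i).factorial : ℝ) / ∏ i, ((α i).factorial : ℝ) =
      Nat.multinomial Finset.univ α := by
    rw [div_eq_iff (by positivity), mul_comm, ← Nat.cast_prod, ← Nat.cast_mul,
      Nat.multinomial_spec]
  rw [hmult, ← card_wordContent_eq rfl, ← nsmul_eq_mul]
  refine Finset.sum_le_card_nsmul _ _ _ fun p hp => ?_
  rw [← partialDeriv_eq_of_wordContent (Finset.mem_filter.1 hp).2 (hf x hx)]
  exact abs_partialDeriv_le_supNorm hK hf hx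

end DerivNorm

theorem le_of_hasDerivWithinAt_Iic_nonpos {h h' : ℝ → ℝ} {a b : ℝ} (hab : a ≤ b)
    (hcont : ContinuousOn h (Icc a b)) (hh : ∀ t ∈ Ioc a b, HasDerivWithinAt h (h' t) (Iic t) t)
    (hle : ∀ t ∈ Ioc a b, h' t ≤ 0) : h b ≤ h a := by
  have hneg : ∀ t ∈ Ico (-b) (-a), -t ∈ Ioc a b := fun t ht => ⟨lt_neg.2 ht.2, neg_le.2 ht.1⟩
  have hmaps : MapsTo (fun t : ℝ => -t) (Icc (-b) (-a)) (Icc a b) := fun t ht =>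
    ⟨le_neg.2 ht.2, neg_le.2 ht.1⟩
  have hrefl : ∀ t ∈ Ico (-b) (-a), HasDerivWithinAt (fun t => -h (-t)) (h' (-t)) (Ici t) t := by
    intro t ht
    have hcomp := (hh (-t) (hneg t ht)).comp t
      (hasDerivAt_neg t).hasDerivWithinAt fun u (hu : u ∈ Ici t) => mem_Iic.2 (neg_le_neg hu)
    simpa [Function.comp_def] using hcomp.fun_neg
  have := image_le_of_deriv_right_le_deriv_boundary (B := fun _ => -h b) (B' := 0)
    (hcont.comp continuousOn_neg hmaps).neg hrefl (by simp) continuousOn_const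
    (fun t _ => hasDerivWithinAt_const ..) (fun t ht => hle _ (hneg t ht))
    (right_mem_Icc.2 (neg_le_neg hab))
  simpa using this

section Interpolation

variable {g : ℝ → ℝ} {s : ℝ}

theorem leftDeriv_eq_derivWithin {a b : ℝ} (ha : 1 ≤ a) (hg : ContDiffOn ℝ 1 g (Icc a b))
    (hs : s ∈ Ioc a b) : leftDeriv g s = derivWithin g (Icc a b) s := by
  have hd := (hg.differentiableOn one_ne_zero s (Ioc_subset_Icc_self hs)).hasDerivWithinAt
  rw [leftDeriv, if_neg (ha.trans_lt hs.1).ne']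
  exact ((hd.mono (Icc_subset_Icc_right hs.2)).mono_of_mem_nhdsWithin
    (Icc_mem_nhdsLE hs.1)).derivWithin (uniqueDiffOn_Iic s s self_mem_Iic)

theorem PiecewiseC1.hasDerivWithinAt_leftDeriv (hg : PiecewiseC1 g) (hs : 1 < s) :
    HasDerivWithinAt g (leftDeriv g s) (Iic s) s := by
  obtain ⟨a, ha0, ha, hatop, hC⟩ := hg
  obtain ⟨k, hk⟩ := ha.exists_between_of_tendsto_atTop hatop (ha0.trans_lt hs)
  rw [leftDeriv_eq_derivWithin (ha0 ▸ ha.monotone k.zero_le) (hC k) hk]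
  exact (((hC k).differentiableOn one_ne_zero s (Ioc_subset_Icc_self hk)).hasDerivWithinAt.mono
    (Icc_subset_Icc_right hk.2)).mono_of_mem_nhdsWithin (Icc_mem_nhdsLE hk.1)

namespace FullWeight.IsInterpolation

variable {W : FullWeight} {n i : ℕ}

/-- `s g'(s) / g(s)` is continuous up to the boundary on each of the finitely many pieces. -/
theorem bddAbove_image (hg : W.IsInterpolation g) (n : ℕ) :
    BddAbove ((fun s : ℝ => s * leftDeriv g s / g s) '' Icc 1 (n : ℝ)) := by
  obtain ⟨-, hcont, hpos, ⟨a, ha0, ha, hatop, hC⟩, -⟩ := hg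
  have ha1 : ∀ k, 1 ≤ a k := fun k => ha0 ▸ ha.monotone k.zero_le
  have hpiece : ∀ k, BddAbove ((fun s => s * leftDeriv g s / g s) '' Ioc (a k) (a (k + 1))) := by
    intro k
    have hc : ContinuousOn (fun s => s * derivWithin g (Icc (a k) (a (k + 1))) s / g s)
        (Icc (a k) (a (k + 1))) :=
      (continuousOn_id.mul ((hC k).continuousOn_derivWithin
        (uniqueDiffOn_Icc (ha k.lt_succ_self)) le_rfl)).div
        (hcont.mono fun s hs => (ha1 k).trans hs.1) fun s hs => (hpos s ((ha1 k).trans hs.1)).ne'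
    refine (isCompact_Icc.image_of_continuousOn hc).bddAbove.mono ?_
    rintro _ ⟨s, hs, rfl⟩
    exact ⟨s, Ioc_subset_Icc_self hs, by simp only [leftDeriv_eq_derivWithin (ha1 k) (hC k) hs]⟩
  obtain ⟨m, hm⟩ := (hatop.eventually_ge_atTop (n : ℝ)).exists
  refine (((finite_Iio m).bddAbove_biUnion.2 fun k _ => hpiece k).union
    (bddAbove_singleton (a := 1 * leftDeriv g 1 / g 1))).mono ?_
  rintro _ ⟨s, hs, rfl⟩
  rcases hs.1.eq_or_lt with rfl | h1
  · exact Or.inr rfl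
  · obtain ⟨k, hk⟩ := ha.exists_between_of_tendsto_atTop hatop (ha0.trans_lt h1)
    exact Or.inl (mem_biUnion (ha.lt_iff_lt.1 (hk.1.trans_le (hs.2.trans hm))) ⟨s, hk, rfl⟩)

theorem le_gammaConst (hg : W.IsInterpolation g) (hs : s ∈ Icc 1 (n : ℝ)) :
    s * leftDeriv g s / g s ≤ gammaConst g n :=
  le_csSup (hg.bddAbove_image n) ⟨s, hs, rfl⟩

theorem gammaConst_nonneg (hg : W.IsInterpolation g) (hn : 1 ≤ n) : 0 ≤ gammaConst g n := by
  refine le_trans ?_ (hg.le_gammaConst (s := 1) ⟨le_rfl, by exact_mod_cast hn⟩)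
  rw [leftDeriv, if_pos rfl, one_mul]
  exact div_nonneg hg.1.derivWithin_nonneg (hg.2.2.1 1 le_rfl).le

theorem log_sub_mul_log_le (hg : W.IsInterpolation g) {t : ℝ} (hs : 1 ≤ s) (hst : s ≤ t)
    (htn : t ≤ n) :
    log (g t) - gammaConst g n * log t ≤ log (g s) - gammaConst g n * log s := by
  have hpos := hg.2.2.1
  have hI : ∀ u ∈ Icc s t, 1 ≤ u := fun u hu => hs.trans hu.1
  refine le_of_hasDerivWithinAt_Iic_nonpos (h := fun u => log (g u) - gammaConst g n * log u)
    (h' := fun u => leftDeriv g u / g u - gammaConst g n * u⁻¹) hst ?_ (fun u hu => ?_)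
    fun u hu => ?_
  · exact ((hg.2.1.mono hI).log fun u hu => (hpos u (hI u hu)).ne').sub
      (continuousOn_const.mul (continuousOn_id.log fun u hu => (one_pos.trans_le (hI u hu)).ne'))
  · have hu1 := hs.trans_lt hu.1
    exact ((hg.2.2.2.1.hasDerivWithinAt_leftDeriv hu1).log (hpos u hu1.le).ne').sub
      ((hasDerivAt_log (one_pos.trans hu1).ne').const_mul _).hasDerivWithinAt
  · have hu1 := hs.trans_lt hu.1
    have := hg.le_gammaConst ⟨hu1.le, hu.2.trans htn⟩
    rwa [sub_nonpos, ← div_eq_mul_inv, le_div_iff₀ (one_pos.trans hu1), mul_comm, ← mul_div_assoc]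

theorem hasGrowthExponent (hg : W.IsInterpolation g) (n : ℕ) :
    W.HasGrowthExponent (gammaConst g n) n := by
  intro i hi hin
  have hi' : (1 : ℝ) ≤ i := by exact_mod_cast hi
  have hin' : (i : ℝ) ≤ n := by exact_mod_cast hin
  have hlog := hg.log_sub_mul_log_le hi' hin' le_rfl
  have hμn := W.μ_pos n (hi.trans hin)
  have hi0 : (0 : ℝ) < i := one_pos.trans_le hi'
  have hn0 : (0 : ℝ) < n := hi0.trans_le hin'
  rw [hg.2.2.2.2 n (hi.trans hin), hg.2.2.2.2 i hi] at hlog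
  rw [← log_le_log_iff (by positivity) (W.μ_pos i hi), log_mul hμn.ne' (by positivity),
    log_rpow (by positivity), log_div hi0.ne' hn0.ne']
  linarith

end FullWeight.IsInterpolation

end Interpolation

section Rays

open Module Metric
open scoped ENNReal

theorem setLIntegral_le_of_measure_le {α : Type*} [MeasurableSpace α] {ν : Measure α}
    {g : α → ℝ≥0∞} {S T : Set α} {θ : ℝ≥0∞} (hS : MeasurableSet S) (hT : MeasurableSet T)
    (hfin : ν T ≠ ∞) (hle : ν T ≤ ν S) (hTS : ∀ x ∈ T \ S, g x ≤ θ) (hST : ∀ x ∈ S \ T, θ ≤ g x) :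
    ∫⁻ x in T, g x ∂ν ≤ ∫⁻ x in S, g x ∂ν := by
  have hdiff : ν (T \ S) ≤ ν (S \ T) := by
    refine (ENNReal.add_le_add_iff_left
      (measure_ne_top_of_subset (inter_subset_left (t := S)) hfin)).1 ?_
    rwa [measure_inter_add_sdiff T hS, inter_comm, measure_inter_add_sdiff S hT]
  calc ∫⁻ x in T, g x ∂ν = ∫⁻ x in T ∩ S, g x ∂ν + ∫⁻ x in T \ S, g x ∂ν :=
        (lintegral_inter_add_sdiff g T hS).symm
    _ ≤ ∫⁻ x in T ∩ S, g x ∂ν + θ * ν (T \ S) := by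
        gcongr
        exact (setLIntegral_mono' (hT.diff hS) hTS).trans_eq (setLIntegral_const _ _)
    _ ≤ ∫⁻ x in S ∩ T, g x ∂ν + θ * ν (S \ T) := by rw [inter_comm]; gcongr
    _ ≤ ∫⁻ x in S ∩ T, g x ∂ν + ∫⁻ x in S \ T, g x ∂ν := by
        gcongr
        exact (setLIntegral_const _ _).symm.trans_le (setLIntegral_mono' (hS.diff hT) hST)
    _ = ∫⁻ x in S, g x ∂ν := lintegral_inter_add_sdiff g S hT

theorem setLIntegral_pow_Ioc {a b : ℝ} (k : ℕ) (ha : 0 ≤ a) (hab : a ≤ b) :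
    ∫⁻ r in Ioc a b, ENNReal.ofReal (r ^ k) =
      ENNReal.ofReal ((b ^ (k + 1) - a ^ (k + 1)) / (k + 1)) := by
  rw [← ofReal_integral_eq_lintegral_ofReal, ← intervalIntegral.integral_of_le hab, integral_pow]
  · exact (intervalIntegral.intervalIntegrable_pow k).1
  · filter_upwards [ae_restrict_mem measurableSet_Ioc] with r hr
    exact pow_nonneg (ha.trans hr.1.le) k

theorem setLIntegral_pow_le {T : Set ℝ} {l c : ℝ} (hT : MeasurableSet T) (k : ℕ) (hl : 0 ≤ l)
    (hc0 : 0 ≤ c) (hc1 : c ≤ 1) (hTl : T ⊆ Ioc 0 l) (hTc : volume T ≤ ENNReal.ofReal (c * l)) :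
    ∫⁻ r in T, ENNReal.ofReal (r ^ k) ≤
      ENNReal.ofReal (1 - (1 - c) ^ (k + 1)) * ∫⁻ r in Ioc 0 l, ENNReal.ofReal (r ^ k) := by
  have hc : 0 ≤ 1 - c := sub_nonneg.2 hc1
  have ha : 0 ≤ (1 - c) * l := mul_nonneg hc hl
  have hal : (1 - c) * l ≤ l := mul_le_of_le_one_left hl (sub_le_self 1 hc0)
  have hvol : volume T ≤ volume (Ioc ((1 - c) * l) l) := by
    rwa [Real.volume_Ioc, show l - (1 - c) * l = c * l by ring]
  calc ∫⁻ r in T, ENNReal.ofReal (r ^ k)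
      ≤ ∫⁻ r in Ioc ((1 - c) * l) l, ENNReal.ofReal (r ^ k) := by
        refine setLIntegral_le_of_measure_le (θ := ENNReal.ofReal (((1 - c) * l) ^ k))
          measurableSet_Ioc hT (hTc.trans_lt ENNReal.ofReal_lt_top).ne hvol
          (fun r hr => ?_) fun r hr => ?_
        · have hr' : r ≤ (1 - c) * l := not_lt.1 fun h => hr.2 ⟨h, (hTl hr.1).2⟩
          exact ENNReal.ofReal_le_ofReal (pow_le_pow_left₀ (hTl hr.1).1.le hr' k)
        · exact ENNReal.ofReal_le_ofReal (pow_le_pow_left₀ ha hr.1.1.le k)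
    _ = _ := by
        rw [setLIntegral_pow_Ioc k ha hal, setLIntegral_pow_Ioc k le_rfl hl, ← ENNReal.ofReal_mul
          (sub_nonneg.2 (pow_le_one₀ hc (sub_le_self 1 hc0)))]
        congr 1
        rw [mul_pow]
        ring

variable {F : Type*} [NormedAddCommGroup F] [NormedSpace ℝ F] {A L : Set F} {x₀ v : F}

/-- The parameters `t > 0` at which the ray from `x₀` in direction `v` meets `A`. -/
def raySlice (A : Set F) (x₀ v : F) : Set ℝ := {t | 0 < t ∧ x₀ + t • v ∈ A}

theorem raySlice_subset_raySlice (h : A ⊆ L) : raySlice A x₀ v ⊆ raySlice L x₀ v :=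
  fun _ ht => ⟨ht.1, h ht.2⟩

theorem measurableSet_raySlice [MeasurableSpace F] [BorelSpace F] (hA : MeasurableSet A) :
    MeasurableSet (raySlice A x₀ v) :=
  measurableSet_Ioi.inter
    (hA.preimage (by fun_prop : Continuous fun t : ℝ => x₀ + t • v).measurable)

theorem exists_raySlice_eq_Ioc (hLc : Convex ℝ L) (hLk : IsCompact L) (hx₀ : x₀ ∈ L)
    (hv : v ≠ 0) : ∃ l : ℝ, 0 ≤ l ∧ raySlice L x₀ v = Ioc 0 l := by
  set S : Set ℝ := {t | 0 ≤ t ∧ x₀ + t • v ∈ L}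
  have hSne : S.Nonempty := ⟨0, le_rfl, by simpa using hx₀⟩
  have hSb : BddAbove S := by
    refine ⟨diam L / ‖v‖, fun t ht => ?_⟩
    have hdist := dist_le_diam_of_mem hLk.isBounded ht.2 hx₀
    rwa [dist_self_add_left, norm_smul, norm_of_nonneg ht.1, ← le_div_iff₀ (norm_pos_iff.2 hv)]
      at hdist
  have hScl : IsClosed S := isClosed_Ici.inter (hLk.isClosed.preimage
    (by fun_prop : Continuous fun t : ℝ => x₀ + t • v))
  obtain ⟨hl, hlL⟩ := hScl.csSup_mem hSne hSb
  refine ⟨sSup S, hl, Subset.antisymm (fun t ht => ⟨ht.1, le_csSup hSb ⟨ht.1.le, ht.2⟩⟩) ?_⟩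
  rintro t ⟨ht0, htl⟩
  have hseg := hLc.add_smul_mem hx₀ hlL (t := t / sSup S)
    ⟨div_nonneg ht0.le hl, div_le_one_of_le₀ htl hl⟩
  rw [smul_smul, div_mul_cancel₀ _ (ht0.trans_le htl).ne'] at hseg
  exact ⟨ht0, hseg⟩

variable [FiniteDimensional ℝ F] [Nontrivial F] [MeasurableSpace F] [BorelSpace F]
  {μ : Measure F} [μ.IsAddHaarMeasure]

theorem measure_eq_lintegral_sphere (hA : MeasurableSet A) :
    μ A = ∫⁻ v : sphere (0 : F) 1, ∫⁻ r in raySlice A 0 v,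
      ENNReal.ofReal (r ^ (finrank ℝ F - 1)) ∂volume ∂μ.toSphere := by
  set B : Set (sphere (0 : F) 1 × Ioi (0 : ℝ)) := {p | (p.2 : ℝ) • (p.1 : F) ∈ A} with hB
  have hBm : MeasurableSet B := hA.preimage (by fun_prop : Continuous
    fun p : sphere (0 : F) 1 × Ioi (0 : ℝ) => (p.2 : ℝ) • (p.1 : F)).measurable
  have hpre : homeomorphUnitSphereProd F ⁻¹' B = Subtype.val ⁻¹' A := by
    ext x
    have hx : (x : F) ≠ 0 := x.2
    simp [hB, smul_smul, hx]
  have hpolar := μ.measurePreserving_homeomorphUnitSphereProd.measure_preimage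
    hBm.nullMeasurableSet
  rw [hpre, comap_subtype_coe_apply (measurableSet_singleton _).compl,
    Subtype.image_preimage_coe, inter_comm, ← Set.sdiff_eq,
    measure_sdiff_null (measure_singleton _), Measure.prod_apply hBm] at hpolar
  rw [hpolar]
  refine lintegral_congr fun v => ?_
  rw [Measure.volumeIoiPow, withDensity_apply _ (measurable_prodMk_left hBm),
    setLIntegral_subtype measurableSet_Ioi _ fun r : ℝ => ENNReal.ofReal (r ^ (finrank ℝ F - 1))]
  congr 2
  ext r
  simp [hB, raySlice, and_comm]

theorem measure_eq_lintegral_raySlice (hA : MeasurableSet A) (x₀ : F) :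
    μ A = ∫⁻ v : sphere (0 : F) 1, ∫⁻ r in raySlice A x₀ v,
      ENNReal.ofReal (r ^ (finrank ℝ F - 1)) ∂volume ∂μ.toSphere := by
  rw [← measure_preimage_add μ x₀ A,
    measure_eq_lintegral_sphere (hA.preimage (measurable_const_add x₀))]
  simp only [raySlice, mem_preimage, zero_add]

theorem exists_lt_volume_raySlice (hLc : Convex ℝ L) (hLk : IsCompact L) (hx₀ : x₀ ∈ L)
    (hA : NullMeasurableSet A μ) (hAL : A ⊆ L) {c : ℝ} (hc0 : 0 ≤ c) (hc1 : c ≤ 1)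
    (h : ENNReal.ofReal (1 - (1 - c) ^ finrank ℝ F) * μ L < μ A) :
    ∃ (v : F) (l : ℝ), ‖v‖ = 1 ∧ raySlice L x₀ v = Ioc 0 l ∧
      ENNReal.ofReal (c * l) < volume (raySlice A x₀ v) := by
  obtain ⟨B, hBA, hB, hBA_ae⟩ := hA.exists_measurable_subset_ae_eq
  have hslice (v : sphere (0 : F) 1) :=
    exists_raySlice_eq_Ioc hLc hLk hx₀ (ne_zero_of_mem_unit_sphere v)
  choose l hl hlS using hslice
  by_contra! hcon
  refine h.not_ge ?_
  rw [← measure_congr hBA_ae, measure_eq_lintegral_raySlice hB x₀,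
    measure_eq_lintegral_raySlice hLk.measurableSet x₀,
    ← lintegral_const_mul' _ _ ENNReal.ofReal_ne_top]
  refine lintegral_mono fun v => ?_
  have hsub : raySlice B x₀ (v : F) ⊆ Ioc 0 (l v) :=
    hlS v ▸ raySlice_subset_raySlice (hBA.trans hAL)
  have hvol : volume (raySlice B x₀ (v : F)) ≤ ENNReal.ofReal (c * l v) :=
    (measure_mono (raySlice_subset_raySlice hBA)).trans
      (hcon v (l v) (norm_eq_of_mem_sphere v) (hlS v))
  have hpow := setLIntegral_pow_le (measurableSet_raySlice hB) (finrank ℝ F - 1) (hl v) hc0 hc1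
    hsub hvol
  rwa [Nat.sub_add_cancel finrank_pos, ← hlS v] at hpow

end Rays

section AssociatedInteger

theorem exp_neg_jZero_le {b : ℝ} (hb : 0 < b) : exp (-(jZero b : ℝ)) ≤ b := by
  rw [← le_log_iff_exp_le hb, neg_le, ← log_inv]
  exact Nat.le_ceil _

namespace IsAssociatedInteger

variable {W : FullWeight} {d : ℕ} {K : Set (EuclideanSpace ℝ (Fin d))} {b : ℝ} {N n : ℕ}

theorem lt_of_sum_lt (hN : IsAssociatedInteger W K b N)
    (hn : ∑ j ∈ Finset.Icc (jZero (b / (2 * W.M0)) + 1) n, 1 / (Metric.diam K * W.μ j) < exp 1) :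
    n < N := by
  have hle : (n : ℕ∞) + 1 ≤ N := by
    rw [hN]
    gcongr
    exact le_sSup ⟨n, hn, rfl⟩
  exact_mod_cast hle

theorem jZero_lt (hN : IsAssociatedInteger W K b N) : jZero (b / (2 * W.M0)) < N :=
  hN.lt_of_sum_lt (by simpa using exp_pos 1)

theorem exp_mul_diam_le_sum (hN : IsAssociatedInteger W K b N) (hn : N ≤ n) :
    exp 1 * Metric.diam K ≤ ∑ i ∈ Finset.Ioc (jZero (b / (2 * W.M0))) n, 1 / W.μ i := by
  have hsum := not_lt.1 fun h => (hN.lt_of_sum_lt h).ne rfl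
  simp only [one_div, mul_inv, ← Finset.mul_sum] at hsum ⊢
  have hdiam : 0 < Metric.diam K := by
    refine Metric.diam_nonneg.lt_of_ne fun h => (exp_pos 1).not_ge ?_
    rwa [← h, inv_zero, zero_mul] at hsum
  rw [le_inv_mul_iff₀ hdiam, mul_comm] at hsum
  refine hsum.trans (Finset.sum_le_sum_of_subset_of_nonneg ?_ fun i hi _ => ?_)
  · exact (Finset.Icc_subset_Icc_right hn).trans_eq (Finset.Icc_succ_left_eq_Ioc ..)
  · exact (inv_pos.2 (W.μ_pos i (Nat.one_le_of_lt (Finset.mem_Ioc.1 hi).1))).le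

end IsAssociatedInteger

end AssociatedInteger

section DirectionallySmooth

open Module

variable {F : Type*} [NormedAddCommGroup F] [NormedSpace ℝ F] {W : FullWeight} {q : ℕ}
  {f : F → ℝ} {L E : Set F} {x₀ v : F}

/-- `f` is `C^q` at the points of `L`, and the derivatives of order `j ≤ q` of the restrictions of
`f` to the lines through these points are bounded by `M_j`. -/
structure FullWeight.IsDirectionallySmooth (W : FullWeight) (q : ℕ) (L : Set F) (f : F → ℝ) :
    Prop where
  contDiffAt : ∀ x ∈ L, ContDiffAt ℝ q f x
  abs_le : ∀ j ≤ q, ∀ x ∈ L, ∀ v, ‖v‖ = 1 → |iteratedFDeriv ℝ j f x fun _ => v| ≤ W.M j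

theorem FullWeight.IsSmooth.isDirectionallySmooth {d : ℕ} {K : Set (EuclideanSpace ℝ (Fin d))}
    {f : EuclideanSpace ℝ (Fin d) → ℝ} (hf : W.IsSmooth q K f) (hK : IsCompact K) :
    W.IsDirectionallySmooth q K f := by
  obtain ⟨⟨U, hU, hKU, hfU⟩, hfM⟩ := hf
  have hdiff : ∀ x ∈ K, ContDiffAt ℝ q f x := fun x hx => by
    exact_mod_cast hfU.contDiffAt (hU.mem_nhds (hKU hx))
  refine ⟨hdiff, fun j hj x hx v hv => ?_⟩
  exact (abs_iteratedFDeriv_le_derivNorm hK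
    (fun y hy => (hdiff y hy).of_le (by exact_mod_cast hj)) hx hv.le).trans
    (hfM j (by exact_mod_cast hj))

namespace FullWeight.IsDirectionallySmooth

theorem mono (hf : W.IsDirectionallySmooth q L f) (hE : E ⊆ L) : W.IsDirectionallySmooth q E f :=
  ⟨fun x hx => hf.contDiffAt x (hE hx), fun j hj x hx => hf.abs_le j hj x (hE hx)⟩

theorem continuousOn (hf : W.IsDirectionallySmooth q L f) : ContinuousOn f L :=
  fun x hx => (hf.contDiffAt x hx).continuousAt.continuousWithinAt

theorem isSmoothChain {S : Set ℝ} (hf : W.IsDirectionallySmooth q L f) (hv : ‖v‖ = 1)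
    (hS : ∀ t ∈ S, x₀ + t • v ∈ L) :
    W.IsSmoothChain q (fun j t => iteratedFDeriv ℝ j f (x₀ + t • v) fun _ => v) S :=
  ⟨fun _ hj t ht => hasDerivAt_iteratedFDeriv_line (hf.contDiffAt _ (hS t ht)) hj,
    fun j hj t ht => hf.abs_le j hj _ (hS t ht) v hv⟩

variable [FiniteDimensional ℝ F] [Nontrivial F] [MeasurableSpace F] [BorelSpace F]
  {μ : Measure F} [μ.IsAddHaarMeasure] {j₀ : ℕ} {γ ε : ℝ}

theorem abs_le_of_measure_lt (hf : W.IsDirectionallySmooth q L f) (hLc : Convex ℝ L)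
    (hLk : IsCompact L) (hq : 1 ≤ q) (hj₀ : 2 * j₀ ≤ q)
    (hsum : exp 1 * Metric.diam L ≤ ∑ i ∈ Finset.Ioc j₀ q, 1 / W.μ i) (hγ : 0 ≤ γ)
    (hW : W.HasGrowthExponent γ q) (hx₀ : x₀ ∈ L) (hfx₀ : exp (-(j₀ : ℝ)) * W.M0 ≤ |f x₀|)
    (hE : NullMeasurableSet E μ) (hEL : E ⊆ L) (hfE : ∀ x ∈ E, |f x| ≤ ε) {c : ℝ} (hc0 : 0 < c)
    (hc1 : c ≤ 1) (hc : ENNReal.ofReal (1 - (1 - c) ^ finrank ℝ F) * μ L < μ E) :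
    |f x₀| ≤ (4 * exp (2 + γ) / c) ^ q * ε := by
  obtain ⟨v, l, hv, hLl, hEl⟩ := exists_lt_volume_raySlice hLc hLk hx₀ hE hEL hc0.le hc1 hc
  have hEsub : raySlice E x₀ v ⊆ Ioc 0 l := hLl ▸ raySlice_subset_raySlice hEL
  obtain ⟨t, ht⟩ := nonempty_of_measure_ne_zero (pos_of_gt hEl).ne'
  have hl : 0 < l := (hEsub ht).1.trans_le (hEsub ht).2
  have hmem : ∀ t ∈ Icc 0 l, x₀ + t • v ∈ L := by
    rintro t ⟨ht0, htl⟩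
    rcases ht0.eq_or_lt with rfl | ht0
    · simpa using hx₀
    · exact (hLl.ge ⟨ht0, htl⟩ : t ∈ raySlice L x₀ v).2
  have hldiam : l ≤ Metric.diam L := by
    have hdist := Metric.dist_le_diam_of_mem hLk.isBounded (hmem l ⟨hl.le, le_rfl⟩) hx₀
    rwa [dist_self_add_left, norm_smul, hv, mul_one, norm_of_nonneg hl.le] at hdist
  have hone := (hf.isSmoothChain hv hmem).abs_left_le (A := raySlice E x₀ v \ {l}) (m := c * l)
    (ε := ε) hq hj₀ (by rw [sub_zero]; exact le_trans (by gcongr) hsum) hγ hW (by simpa using hfx₀)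
    (fun t ht => ⟨(hEsub ht.1).1.le, (hEsub ht.1).2.lt_of_ne ht.2⟩) (mul_pos hc0 hl)
    (by rw [measure_sdiff_null (measure_singleton l)]; exact hEl.le)
    (fun t ht => by simpa using hfE _ ht.1.2)
  simpa [mul_div_mul_right _ _ hl.ne'] using hone

end FullWeight.IsDirectionallySmooth

theorem one_sub_one_sub_pow_mul_lt {a b c : ℝ} {d : ℕ} (hd : d ≠ 0) (hb : 0 ≤ b) (hba : b < a)
    (hc : c < (a ^ ((1 : ℝ) / d) - b ^ ((1 : ℝ) / d)) / a ^ ((1 : ℝ) / d)) :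
    (1 - (1 - c) ^ d) * a < a - b := by
  have ha := hb.trans_lt hba
  rw [lt_div_iff₀ (by positivity)] at hc
  have hpow : (b ^ ((1 : ℝ) / d)) ^ d < ((1 - c) * a ^ ((1 : ℝ) / d)) ^ d :=
    pow_lt_pow_left₀ (by linarith) (by positivity) hd
  rw [mul_pow, one_div, rpow_inv_natCast_pow ha.le hd, rpow_inv_natCast_pow hb hd] at hpow
  linarith

theorem FullWeight.IsDirectionallySmooth.abs_le_of_measure_pos [FiniteDimensional ℝ F]
    [Nontrivial F] [MeasurableSpace F] [BorelSpace F] {μ : Measure F} [μ.IsAddHaarMeasure]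
    {j₀ : ℕ} {γ ε : ℝ} (hf : W.IsDirectionallySmooth q L f) (hLc : Convex ℝ L)
    (hLk : IsCompact L) (hq : 1 ≤ q) (hj₀ : 2 * j₀ ≤ q)
    (hsum : exp 1 * Metric.diam L ≤ ∑ i ∈ Finset.Ioc j₀ q, 1 / W.μ i) (hγ : 0 ≤ γ)
    (hW : W.HasGrowthExponent γ q) (hx₀ : x₀ ∈ L) (hfx₀ : exp (-(j₀ : ℝ)) * W.M0 ≤ |f x₀|)
    (hE : NullMeasurableSet E μ) (hEL : E ⊆ L) (hE0 : 0 < μ E) (hfE : ∀ x ∈ E, |f x| ≤ ε) :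
    |f x₀| ≤ (4 * exp (2 + γ) * μ.real L ^ ((1 : ℝ) / finrank ℝ F) /
      (μ.real L ^ ((1 : ℝ) / finrank ℝ F) -
        (μ.real L - μ.real E) ^ ((1 : ℝ) / finrank ℝ F))) ^ q * ε := by
  have hLfin : μ L ≠ ⊤ := hLk.measure_lt_top.ne
  have hEfin : μ E ≠ ⊤ := measure_ne_top_of_subset hEL hLfin
  have hd : finrank ℝ F ≠ 0 := finrank_pos.ne'
  have hVE : 0 < μ.real E := ENNReal.toReal_pos hE0.ne' hEfin
  have hVLE : 0 ≤ μ.real L - μ.real E := sub_nonneg.2 (measureReal_mono hEL hLfin)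
  have hVL : 0 < μ.real L := by linarith
  set p := μ.real L ^ ((1 : ℝ) / finrank ℝ F)
  set w := (μ.real L - μ.real E) ^ ((1 : ℝ) / finrank ℝ F)
  have hp0 : 0 < p := by positivity
  have hw0 : 0 ≤ w := by positivity
  have hwp : w < p := rpow_lt_rpow hVLE (by linarith) (by positivity)
  have hc0 : 0 < (p - w) / p := div_pos (sub_pos.2 hwp) hp0
  have hc1 : (p - w) / p ≤ 1 := (div_le_one hp0).2 (by linarith)
  have hlt : ∀ c ∈ Ioo 0 ((p - w) / p), |f x₀| ≤ (4 * exp (2 + γ) / c) ^ q * ε := fun c hc => by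
    refine hf.abs_le_of_measure_lt hLc hLk hq hj₀ hsum hγ hW hx₀ hfx₀ hE hEL hfE hc.1
      (hc.2.le.trans hc1) ?_
    rw [← ofReal_measureReal hLfin, ← ofReal_measureReal hEfin, ← ENNReal.ofReal_mul' hVL.le,
      ENNReal.ofReal_lt_ofReal_iff hVE]
    linarith [one_sub_one_sub_pow_mul_lt hd hVLE (by linarith) hc.2]
  have hcont : ContinuousAt (fun c : ℝ => (4 * exp (2 + γ) / c) ^ q * ε) ((p - w) / p) := by
    fun_prop (disch := exact hc0.ne')
  rw [← div_div_eq_mul_div]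
  refine ge_of_tendsto (x := 𝓝[<] ((p - w) / p)) (hcont.mono_left nhdsWithin_le_nhds) ?_
  filter_upwards [Ioo_mem_nhdsLT hc0] using hlt

end DirectionallySmooth

end Remez

open Remez in
theorem mainTheorem4_general {d : ℕ} (hd : 1 ≤ d) {W : FullWeight} {γ : ℝ} (hγ : 0 ≤ γ)
    {K : Set (EuclideanSpace ℝ (Fin d))} (hK : IsCompact K) {b : ℝ} (hb : 0 < b) {N : ℕ}
    (hN : IsAssociatedInteger W K (2 * b) N) (hN1 : N ≠ 1)
    (hW : W.HasGrowthExponent γ (2 * (N - 1)))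
    {f : EuclideanSpace ℝ (Fin d) → ℝ} (hf : W.IsSmooth ((2 * (N - 1) : ℕ) : ℕ∞) K f)
    {L : Set (EuclideanSpace ℝ (Fin d))} (hLc : Convex ℝ L) (hLk : IsCompact L) (hLK : L ⊆ K)
    (hfL : b ≤ supNorm f L) {E : Set (EuclideanSpace ℝ (Fin d))}
    (hE : NullMeasurableSet E volume) (hEL : E ⊆ L) (hEpos : 0 < volume E) :
    supNorm f L ≤
      (4 * Real.exp (2 + γ) * volume.real L ^ ((1 : ℝ) / d) /
        (volume.real L ^ ((1 : ℝ) / d) - (volume.real L - volume.real E) ^ ((1 : ℝ) / d)))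
          ^ (2 * (N - 1)) * supNorm f E := by
  have : Nonempty (Fin d) := ⟨⟨0, hd⟩⟩
  have hj₀ := hN.jZero_lt
  have hfL' := (hf.isDirectionallySmooth hK).mono hLK
  have hsum : Real.exp 1 * Metric.diam L ≤ _ :=
    (mul_le_mul_of_nonneg_left (Metric.diam_mono hLK hK.isBounded) (Real.exp_pos 1).le).trans
      (hN.exp_mul_diam_le_sum (n := 2 * (N - 1)) (by omega))
  have hLne : L.Nonempty := (nonempty_of_measure_ne_zero hEpos.ne').mono hEL
  obtain ⟨x₀, hx₀, hsup, -⟩ := hLk.exists_sSup_image_eq_and_ge hLne hfL'.continuousOn.abs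
  have hbound : BddAbove ((fun x => |f x|) '' E) :=
    (hLk.bddAbove_image hfL'.continuousOn.abs).mono (Set.image_mono hEL)
  have hexp : Real.exp (-(jZero (2 * b / (2 * W.M0)) : ℝ)) * W.M0 ≤ b := by
    rw [mul_div_mul_left _ _ two_ne_zero, ← le_div_iff₀ W.M0_pos]
    exact exp_neg_jZero_le (div_pos hb W.M0_pos)
  have key := hfL'.abs_le_of_measure_pos (μ := volume) hLc hLk (by omega) (by omega) hsum hγ hW hx₀
    (hexp.trans (hfL.trans_eq hsup)) hE hEL hEpos fun x hx => le_csSup hbound ⟨x, hx, rfl⟩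
  rwa [finrank_euclideanSpace_fin, ← hsup] at key

open Remez in
theorem mainTheorem4 (d : ℕ) (hd : 1 ≤ d) (W : Remez.FullWeight)
    (μt : ℝ → ℝ) (hμt : W.IsInterpolation μt)
    (K : Set (EuclideanSpace ℝ (Fin d))) (b : ℝ)
    (hadm : Remez.AdmissibleData W K (2 * b))
    (N : ℕ) (hN : Remez.IsAssociatedInteger W K (2 * b) N)
    -- for `N = 1` the constant is `∞` by convention and nothing is claimed
    (hN1 : N ≠ 1)
    (f : EuclideanSpace ℝ (Fin d) → ℝ) (hf : W.IsSmooth ((2 * (N - 1) : ℕ) : ℕ∞) K f)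
    (L : Set (EuclideanSpace ℝ (Fin d))) (hL : Remez.IsConvexBody L) (hLK : L ⊆ K)
    (hfL : b ≤ Remez.supNorm f L)
    (E : Set (EuclideanSpace ℝ (Fin d))) (hE : NullMeasurableSet E volume) (hEL : E ⊆ L)
    (hEpos : 0 < volume E) :
    Remez.supNorm f L ≤
      (Remez.GammaConst μt (2 * (N - 1)) * volume.real L ^ ((1 : ℝ) / d) /
        (volume.real L ^ ((1 : ℝ) / d) - (volume.real L - volume.real E) ^ ((1 : ℝ) / d)))
          ^ (2 * (N - 1)) * Remez.supNorm f E := by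
  have hq : 1 ≤ 2 * (N - 1) := by have := hN.jZero_lt; omega
  have hL0 : volume L ≠ ⊤ := hL.2.1.measure_lt_top.ne
  have hroot : (volume.real L - volume.real E) ^ ((1 : ℝ) / d) ≤ volume.real L ^ ((1 : ℝ) / d) :=
    Real.rpow_le_rpow (sub_nonneg.2 (measureReal_mono hEL hL0))
      (sub_le_self _ measureReal_nonneg) (by positivity)
  refine (mainTheorem4_general hd (hμt.gammaConst_nonneg hq) hadm.1.2.1 (by linarith [hadm.2.1]) hN
    hN1 (hμt.hasGrowthExponent _) hf hL.1 hL.2.1 hLK hfL hE hEL hEpos).trans ?_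
  have hε : 0 ≤ supNorm f E := Real.sSup_nonneg (by rintro _ ⟨x, -, rfl⟩; exact abs_nonneg _)
  have := sub_nonneg.2 hroot
  unfold GammaConst
  gcongr
  norm_num
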